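/- **Setting.** Let $X,Y$ be real Hilbert spaces, and let $X\times Y$ carry the product norm $\|(u,v)\|^2=\|u\|^2+\|v\|^2$. Let $G:X\to\mathbb R\cup\{+\infty\}$ and $F:Y\to\mathbb R\cup\{+\infty\}$ be convex, proper and lower semicontinuous with $\operatorname{int}\operatorname{dom}G\neq\emptyset$ and $\operatorname{int}\operatorname{dom}F\ne\emptyset$. Let $F^*$ be the Fenchel conjugate of $F$, and let $\partial$ be the convex subdifferential. Let $K:X\to Y$ be Fréchet differentiable with locally Lipschitz derivative $\nabla K$. For $\bar u\in X$ define the set-valued map $$H_{\bar u}(u,v)=\begin{pmatrix}\partial G(u)+\nabla K(\bar u)^*v\\ \partial F^*(v)-\nabla K(\bar u)u-c_{\bar u}\end{pmatrix},\qquad c_{\bar u}=K(\bar u)-\nabla K(\bar u)\bar u .$$ Let $R>0$, let $\hat q=(\hat u,\hat v)$ satisfy $0\in H_{\hat u}(\hat q)$ and $\|\hat q\|\le R/2$, and let $L_2\geq 0$ be a Lipschitz constant of $u\mapsto\nabla K(u)$ on the closed ball $B(0,R)\subset X$. **Strong convexity and step lengths.** Suppose that $G$ is strongly convex with constant $\gamma_G>0$,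 i.e. $G(u')-G(u)\ge\langle z,u'-u\rangle+\frac{\gamma_G}2\|u'-u\|^2$ for all $u,u'\in X$ and $z\in\partial G(u)$. Let $\mu\in[0,\gamma_G)$, $N\in\mathbb N$ and $\tau_0,\sigma_0>0$. For $i\geq 0$ set $\tau_{i+1}=\omega_i\tau_i$ and $\sigma_{i+1}=\sigma_i/\omega_i$, where $\omega_i=1/\sqrt{1+2\mu\tau_i}$ for $i<N$ and $\omega_i=1$ for $i\ge N$ (the acceleration is stopped, so $\tau_i=\tau_N$ and $\sigma_i=\sigma_N$ for $i\ge N$). Suppose that $\sigma_i\tau_i\sup_{\|u\|\le R}\|\nabla K(u)\|^2<1$ for all $i$ (the product $\sigma_i\tau_i$ does not depend on $i$). Let $\theta,\Theta>0$ be such that $$\theta^2\,\mathrm{Id}\le\begin{pmatrix}\tau_i^{-1}\mathrm{Id}&-\nabla K(u)^*\\-\nabla K(u)&\sigma_i^{-1}\mathrm{Id}\end{pmatrix}\le\Theta^2\,\mathrm{Id}\qquad\text{for all }i\ge 0\text{ and }\|u\|\le R,$$ and put $\kappa=\Theta/\theta$. **Metric regularity.** Suppose that $H_{\hat u}$ is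 metrically regular at $0$ for $\hat q$. That is, its graph is locally closed, and there are $\rho,\delta',\ell'>0$ with $$\inf_{p:\,w\in H_{\hat u}(p)}\|q-p\|\le\ell'\inf_{w'\in H_{\hat u}(q)}\|w-w'\|\qquad\text{whenever }\|q-\hat q\|\le\delta',\ \|w\|\le\rho$$ (an infimum over the empty set is $+\infty$). Let $\ell\ge 0$ be the infimum of the constants $\ell'>0$ that are valid for some $\rho,\delta'>0$, and suppose that $$\ell\,\kappa\,L_2\,\|\hat v\|<1-\frac1{\sqrt{1+1/(2\ell^2\Theta^4)}},$$ where for $\ell=0$ the right-hand side is understood as its limit $1$, so that the condition then holds. **Conclusion.** There is $\delta>0$ such that for every $q^0=(u^0,v^0)\in X\times Y$ with $\|q^0-\hat q\|\le\delta$ the iterates $q^i=(u^i,v^i)$ given for $i\ge0$ by $$u^{i+1}=\mathrm{prox}_{\tau_iG}\big(u^i-\tau_i\nabla K(u^i)^*v^i\big),\quad \bar u^{i+1}=u^{i+1}+\omega_i(u^{i+1}-u^i),\quad v^{i+1}=\mathrm{prox}_{\sigma_iF^*}\big(v^i+\sigma_iK(\bar u^{i+1})\big),$$ where $\mathrm{prox}_f(z)=\arg\min_w\frac12\|w-z\|^2+f(w)$,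 exist and converge in norm to some $q^*=(u^*,v^*)$ which solves the optimality system $$K(u^*)\in\partial F^*(v^*),\qquad -\nabla K(u^*)^*v^*\in\partial G(u^*).$$ The same holds if $\sigma_{i+1}$ is used in place of $\sigma_i$ in the update of $v^{i+1}$, for all $i$. -/

import Mathlib

open Filter Topology
open scoped NNReal ENNReal InnerProductSpace

noncomputable section

namespace NonlinearPDHG

section ConvexAnalysis

variable {E : Type*} [NormedAddCommGroup E] [InnerProductSpace ℝ E]

/-- A convex, proper, lower semicontinuous functional with values in `ℝ ∪ {+∞}` whose
effective domain has nonempty interior. -/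
structure IsConvexFunctional (f : E → EReal) : Prop where
  convex_epigraph : Convex ℝ {p : E × ℝ | f p.1 ≤ (p.2 : EReal)}
  ne_bot : ∀ x, f x ≠ ⊥
  exists_ne_top : ∃ x, f x ≠ ⊤
  lsc : LowerSemicontinuous f
  interior_dom : (interior {x | f x ≠ ⊤}).Nonempty

/-- The convex subdifferential `∂f(x)`; it is empty outside the effective domain. -/
def subdiff (f : E → EReal) (x : E) : Set E :=
  {z | f x ≠ ⊤ ∧ ∀ x', f x + ((⟪z, x' - x⟫_ℝ : ℝ) : EReal) ≤ f x'}

/-- Strong convexity with constant `γ`: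
`f(x') - f(x) ≥ ⟪z, x' - x⟫ + (γ / 2) ‖x' - x‖²` for all `x`, `x'` and `z ∈ ∂f(x)`. -/
def IsStronglyConvex (f : E → EReal) (γ : ℝ) : Prop :=
  ∀ x x', ∀ z ∈ subdiff f x,
    f x + ((⟪z, x' - x⟫_ℝ + γ / 2 * ‖x' - x‖ ^ 2 : ℝ) : EReal) ≤ f x'

/-- The Fenchel conjugate (the dual space being identified with `E`). -/
def conj (f : E → EReal) (p : E) : EReal :=
  ⨆ y, ((⟪p, y⟫_ℝ : ℝ) : EReal) - f y

/-- `w = prox_f(v)`, i.e. `w` minimizes `w' ↦ ‖w' - v‖² / 2 + f(w')`. -/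
def IsProx (f : E → EReal) (v w : E) : Prop :=
  ∀ w', ((1 / 2 * ‖w - v‖ ^ 2 : ℝ) : EReal) + f w ≤ ((1 / 2 * ‖w' - v‖ ^ 2 : ℝ) : EReal) + f w'

end ConvexAnalysis

section MetricRegularity

variable {Q W : Type*} [NormedAddCommGroup Q] [NormedAddCommGroup W]

/-- `ℓ` is a valid constant of metric regularity of the set-valued map `R` at `w₀` for `q₀`.
Distances to the empty set are `+∞`. -/
def IsRegularityModulus (R : Q → Set W) (w₀ : W) (q₀ : Q) (ℓ : ℝ) : Prop :=
  0 < ℓ ∧ ∃ ρ > 0, ∃ δ > 0, ∀ q w, ‖q - q₀‖ ≤ δ → ‖w - w₀‖ ≤ ρ →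
    Metric.infEDist q {p | w ∈ R p} ≤ ENNReal.ofReal ℓ * Metric.infEDist w (R q)

/-- Metric regularity of `R` at `w₀` for `q₀`. -/
def MetricallyRegular (R : Q → Set W) (w₀ : W) (q₀ : Q) : Prop :=
  IsLocallyClosed {p : Q × W | p.2 ∈ R p.1} ∧ ∃ ℓ, IsRegularityModulus R w₀ q₀ ℓ

/-- The infimum of the valid constants of metric regularity of `R` at `w₀` for `q₀`. -/
def lipInv (R : Q → Set W) (w₀ : W) (q₀ : Q) : ℝ :=
  sInf {ℓ | IsRegularityModulus R w₀ q₀ ℓ}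

end MetricRegularity

section Method

variable {X Y : Type*} [NormedAddCommGroup X] [InnerProductSpace ℝ X] [CompleteSpace X]
  [NormedAddCommGroup Y] [InnerProductSpace ℝ Y] [CompleteSpace Y]

/-- The adjoint `∇K(u)^*` of the Fréchet derivative. -/
def gradAdj (K : X → Y) (u : X) : Y →L[ℝ] X :=
  ContinuousLinearMap.adjoint (fderiv ℝ K u)

/-- The operator
`H_b(u, v) = (∂G(u) + ∇K(b)^* v, ∂F^*(v) - ∇K(b) u - c_b)` with `c_b = K(b) - ∇K(b) b`,
on the Hilbert space `X × Y`. -/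
def H (K : X → Y) (G : X → EReal) (F : Y → EReal) (b : X) (q : WithLp 2 (X × Y)) :
    Set (WithLp 2 (X × Y)) :=
  {w | w.fst - gradAdj K b q.snd ∈ subdiff G q.fst ∧
    w.snd + fderiv ℝ K b q.fst + (K b - fderiv ℝ K b b) ∈ subdiff (conj F) q.snd}

/-- The first-order optimality system `K(u) ∈ ∂F^*(v)`, `-∇K(u)^* v ∈ ∂G(u)`. -/
def IsCriticalPoint (K : X → Y) (G : X → EReal) (F : Y → EReal) (q : WithLp 2 (X × Y)) : Prop :=
  K q.fst ∈ subdiff (conj F) q.snd ∧ -(gradAdj K q.fst q.snd) ∈ subdiff G q.fst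

/-- The preconditioner with block rows `(τ⁻¹ Id, -∇K(u)^*)` and `(-∇K(u), σ⁻¹ Id)`. -/
def precond (K : X → Y) (τ σ : ℝ) (u : X) (q : WithLp 2 (X × Y)) : WithLp 2 (X × Y) :=
  WithLp.toLp 2 (τ⁻¹ • q.fst - gradAdj K u q.snd, -(fderiv ℝ K u q.fst) + σ⁻¹ • q.snd)

/-- The primal acceleration rule, used for the first `N` updates and then stopped. -/
structure IsPrimalAcceleration (μ : ℝ) (N : ℕ) (τ σ ω : ℕ → ℝ) : Prop where
  tau_pos : 0 < τ 0
  sigma_pos : 0 < σ 0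
  omega_accel : ∀ i < N, ω i = 1 / √(1 + 2 * μ * τ i)
  omega_stop : ∀ i ≥ N, ω i = 1
  tau_succ : ∀ i, τ (i + 1) = ω i * τ i
  sigma_succ : ∀ i, σ (i + 1) = σ i / ω i

/-- The sequence `q i = (u i, v i)` is generated by the accelerated nonlinear primal-dual
extragradient method. The dual step uses the step length `σ (i + s)`: `s = 0` is the old and
`s = 1` the updated one. -/
structure IsIterateSeq (K : X → Y) (G : X → EReal) (F : Y → EReal) (τ σ ω : ℕ → ℝ) (s : ℕ)
    (q : ℕ → WithLp 2 (X × Y)) : Prop where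
  primal : ∀ i, IsProx (fun u => (τ i : EReal) * G u)
    ((q i).fst - τ i • gradAdj K (q i).fst (q i).snd) (q (i + 1)).fst
  dual : ∀ i, IsProx (fun v => (σ (i + s) : EReal) * conj F v)
    ((q i).snd + σ (i + s) • K ((q (i + 1)).fst + ω i • ((q (i + 1)).fst - (q i).fst)))
    (q (i + 1)).snd

end Method

end NonlinearPDHG

end

/-! For `i ≥ N` the step lengths are frozen and `ω i = 1`. The first `N` steps matter only through
continuity: `qhat` is a fixed point of every step, so the iterate number `N` is as close to `qhat`
as needed once the starting point is.

Let T be the map `H K G F qhat.fst` and M the preconditioner at `qhat.fst`. An unaccelerated step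
from q to q' reads -M(q' - q) - g(q) - h ∈ T(q') (`IsStep.exists_inclusion`). Here g is the
linearization error of `K`, Lipschitz near `qhat` with a constant close to η = `L₂ * ‖qhat.snd‖`,
and h is a small multiple of ‖q' - q‖.

The iterates are compared with moving targets p that solve -g(q) ∈ T(p); see
`exists_contracted_solution`. In the norm |·| of M, monotonicity of T yields |q' - p|² + |q' - q|² ≤
|q - p|² up to the effect of h. Metric regularity yields a target within about c|q' - q| of q',
where c is close to ℓΘ². Together these shrink the distance to the target by the factor c/√(1 + c²),
and updating the target from g(q) to g(q') costs about ℓκη more. The smallness condition keeps the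
sum below 1, so the increments decay geometrically and the iterates form a Cauchy sequence
(`exists_cauchySeq_of_steps`). Closedness of the subdifferential graphs identifies the limit. -/

namespace NonlinearPDHG

/-! ### Subdifferentials, proximal points and conjugates. -/

section ConvexAnalysisLemmas

variable {E : Type*} [NormedAddCommGroup E] [InnerProductSpace ℝ E]

theorem exists_coe_of_ne {x : EReal} (hb : x ≠ ⊥) (ht : x ≠ ⊤) : ∃ a : ℝ, x = (a : EReal) :=
  ⟨x.toReal, (EReal.coe_toReal ht hb).symm⟩

theorem subdiff_monotone {f : E → EReal} (hb : ∀ x, f x ≠ ⊥) {x y z w : E}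
    (hz : z ∈ subdiff f x) (hw : w ∈ subdiff f y) : 0 ≤ ⟪z - w, x - y⟫_ℝ := by
  obtain ⟨a, ha⟩ := exists_coe_of_ne (hb x) hz.1
  obtain ⟨b, hb'⟩ := exists_coe_of_ne (hb y) hw.1
  have h1 := hz.2 y
  have h2 := hw.2 x
  rw [ha, hb'] at h1 h2
  norm_cast at h1 h2
  rw [← neg_sub x y, inner_neg_right] at h1
  rw [inner_sub_left]
  linarith

/-- Fermat's rule: compare `w` with the points (1 - t)w + tx, use convexity, divide by t and let t
tend to 0. -/
theorem IsProx.mem_subdiff {f : E → EReal} (hconv : Convex ℝ {p : E × ℝ | f p.1 ≤ (p.2 : EReal)})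
    (hb : ∀ x, f x ≠ ⊥) (ht : ∃ x, f x ≠ ⊤) {τ : ℝ} (hτ : 0 < τ) {z w : E}
    (h : IsProx (fun x => (τ : EReal) * f x) z w) : τ⁻¹ • (z - w) ∈ subdiff f w := by
  have hw : f w ≠ ⊤ := by
    intro hw
    obtain ⟨x, hx⟩ := ht
    obtain ⟨b, hb'⟩ := exists_coe_of_ne (hb x) hx
    have h1 := h x
    simp only [hw, hb', EReal.coe_mul_top_of_pos hτ, EReal.coe_add_top, top_le_iff] at h1
    norm_cast at h1
    exact EReal.coe_ne_top _ h1
  obtain ⟨a, ha⟩ := exists_coe_of_ne (hb w) hw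
  refine ⟨hw, fun x => ?_⟩
  by_cases hx : f x = ⊤
  · rw [hx]; exact le_top
  obtain ⟨b, hb'⟩ := exists_coe_of_ne (hb x) hx
  rw [ha, hb']
  norm_cast
  have key : ∀ t : ℝ, 0 < t → t < 1 →
      0 ≤ ⟪w - z, x - w⟫_ℝ + τ * (b - a) + t * (1 / 2 * ‖x - w‖ ^ 2) := by
    intro t ht0 ht1
    have hmem := hconv (x := (w, a)) (y := (x, b)) (by simp [ha]) (by simp [hb'])
      (sub_nonneg.2 ht1.le) ht0.le (sub_add_cancel 1 t)
    simp only [Set.mem_ofPred_eq, Prod.smul_mk, Prod.mk_add_mk, smul_eq_mul] at hmem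
    set y := (1 - t) • w + t • x with hy
    have hyt : f y ≠ ⊤ := fun h' => by
      rw [h'] at hmem
      exact EReal.coe_ne_top _ (top_le_iff.1 hmem)
    obtain ⟨c, hc⟩ := exists_coe_of_ne (hb y) hyt
    have h1 := h y
    simp only [ha, hc] at h1
    rw [hc] at hmem
    norm_cast at h1 hmem
    have hyz : y - z = (w - z) + t • (x - w) := by rw [hy]; module
    rw [hyz, norm_add_sq_real, norm_smul, inner_smul_right, Real.norm_of_nonneg ht0.le] at h1
    have h2 : τ * c ≤ τ * ((1 - t) * a + t * b) := mul_le_mul_of_nonneg_left hmem hτ.le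
    have h3 : 0 ≤ t * (⟪w - z, x - w⟫_ℝ + τ * (b - a) + t * (1 / 2 * ‖x - w‖ ^ 2)) := by
      nlinarith
    exact nonneg_of_mul_nonneg_right h3 ht0
  have hlim : 0 ≤ ⟪w - z, x - w⟫_ℝ + τ * (b - a) := by
    have hcont : Tendsto (fun t : ℝ => ⟪w - z, x - w⟫_ℝ + τ * (b - a) + t * (1 / 2 * ‖x - w‖ ^ 2))
        (𝓝[>] 0) (𝓝 (⟪w - z, x - w⟫_ℝ + τ * (b - a) + 0 * (1 / 2 * ‖x - w‖ ^ 2))) :=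
      (Continuous.tendsto (by fun_prop) 0).mono_left nhdsWithin_le_nhds
    rw [zero_mul, add_zero] at hcont
    refine ge_of_tendsto hcont ?_
    filter_upwards [Ioo_mem_nhdsGT (zero_lt_one (α := ℝ))] with t ht using key t ht.1 ht.2
  rw [← neg_sub z w, inner_neg_left] at hlim
  rw [real_inner_smul_left]
  have : τ⁻¹ * ⟪z - w, x - w⟫_ℝ ≤ τ⁻¹ * (τ * (b - a)) :=
    mul_le_mul_of_nonneg_left (by linarith) (inv_nonneg.2 hτ.le)
  rw [inv_mul_cancel_left₀ hτ.ne'] at this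
  linarith

theorem norm_sub_le_of_mem_subdiff {f : E → EReal} (hb : ∀ x, f x ≠ ⊥) {τ : ℝ} (hτ : 0 < τ)
    {z w z' w' : E} (h : τ⁻¹ • (z - w) ∈ subdiff f w) (h' : τ⁻¹ • (z' - w') ∈ subdiff f w') :
    ‖w - w'‖ ≤ ‖z - z'‖ := by
  have h1 := subdiff_monotone hb h h'
  rw [← smul_sub, real_inner_smul_left] at h1
  have h2 : 0 ≤ ⟪z - w - (z' - w'), w - w'⟫_ℝ := nonneg_of_mul_nonneg_right h1 (inv_pos.2 hτ)
  rw [show z - w - (z' - w') = (z - z') - (w - w') by abel, inner_sub_left,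
    real_inner_self_eq_norm_sq] at h2
  have h3 := real_inner_le_norm (z - z') (w - w')
  by_contra! hlt
  nlinarith [norm_nonneg (z - z'), norm_nonneg (w - w')]

/-- The objective is minimized over the epigraph, where it is real valued. The parallelogram law
makes a minimizing sequence Cauchy in its first component, and the closed epigraph contains the
limit. -/
theorem exists_isProx [CompleteSpace E] {f : E → EReal}
    (hconv : Convex ℝ {p : E × ℝ | f p.1 ≤ (p.2 : EReal)})
    (hb : ∀ x, f x ≠ ⊥) (hlsc : LowerSemicontinuous f) {x₀ z₀ : E} (hz₀ : z₀ ∈ subdiff f x₀)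
    {τ : ℝ} (hτ : 0 < τ) (z : E) : ∃ w, IsProx (fun x => (τ : EReal) * f x) z w := by
  obtain ⟨c, hc⟩ := exists_coe_of_ne (hb x₀) hz₀.1
  set A := {p : E × ℝ | f p.1 ≤ (p.2 : EReal)} with hA
  set J : E × ℝ → ℝ := fun p => 1 / 2 * ‖p.1 - z‖ ^ 2 + τ * p.2 with hJ
  have hne : (J '' A).Nonempty := ⟨_, (x₀, c), by simp [hA, hc], rfl⟩
  have hbdd : BddBelow (J '' A) := by
    -- The affine minorant of `f` with slope `z₀`, followed by completing the square in `‖w - z‖`.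
    refine ⟨τ * (c + ⟪z₀, z - x₀⟫_ℝ) - 1 / 2 * (τ * ‖z₀‖) ^ 2, ?_⟩
    rintro _ ⟨⟨w, a⟩, hwa, rfl⟩
    have h1 := (hz₀.2 w).trans hwa
    rw [hc] at h1
    norm_cast at h1
    have h2 : ⟪z₀, w - x₀⟫_ℝ = ⟪z₀, w - z⟫_ℝ + ⟪z₀, z - x₀⟫_ℝ := by
      rw [← inner_add_right, sub_add_sub_cancel]
    have h3 := abs_le.1 (abs_real_inner_le_norm z₀ (w - z))
    have h4 : τ * (c + (-(‖z₀‖ * ‖w - z‖) + ⟪z₀, z - x₀⟫_ℝ)) ≤ τ * a :=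
      mul_le_mul_of_nonneg_left (by linarith [h3.1]) hτ.le
    simp only [hJ]
    nlinarith [sq_nonneg (‖w - z‖ - τ * ‖z₀‖)]
  set m := sInf (J '' A) with hm
  have hmle : ∀ p ∈ A, m ≤ J p := fun p hp => csInf_le hbdd ⟨p, hp, rfl⟩
  have hseq : ∀ n : ℕ, ∃ p ∈ A, J p < m + 1 / ((n : ℝ) + 1) := by
    intro n
    obtain ⟨_, ⟨p, hp, rfl⟩, hlt⟩ := exists_lt_of_csInf_lt hne
      (lt_add_of_pos_right m (Nat.one_div_pos_of_nat (α := ℝ) (n := n)))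
    exact ⟨p, hp, hlt⟩
  choose p hpA hpJ using hseq
  have hpar : ∀ n k, ‖(p n).1 - (p k).1‖ ^ 2 ≤ 4 * (1 / ((n : ℝ) + 1) + 1 / ((k : ℝ) + 1)) := by
    intro n k
    have hmid := hmle _ (hconv (hpA n) (hpA k) (by norm_num : (0 : ℝ) ≤ 1 / 2)
      (by norm_num : (0 : ℝ) ≤ 1 / 2) (by norm_num))
    have h1 := hpJ n
    have h2 := hpJ k
    simp only [hJ, Prod.fst_add, Prod.snd_add, Prod.smul_fst, Prod.smul_snd, smul_eq_mul] at hmid h1 h2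
    have h3 : (1 / 2 : ℝ) • (p n).1 + (1 / 2 : ℝ) • (p k).1 - z
        = (1 / 2 : ℝ) • (((p n).1 - z) + ((p k).1 - z)) := by module
    rw [h3, norm_smul, mul_pow] at hmid
    have h4 := parallelogram_law_with_norm ℝ ((p n).1 - z) ((p k).1 - z)
    rw [sub_sub_sub_cancel_right] at h4
    norm_num at hmid
    nlinarith
  have hinv : Tendsto (fun n : ℕ => 1 / ((n : ℝ) + 1)) atTop (𝓝 0) :=
    tendsto_one_div_add_atTop_nhds_zero_nat
  have hcau : CauchySeq fun n => (p n).1 := by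
    rw [Metric.cauchySeq_iff']
    intro ε hε
    obtain ⟨n₀, hn₀⟩ := ((tendsto_order.1 hinv).2 (ε ^ 2 / 8) (by positivity)).exists
    refine ⟨n₀, fun n hn => ?_⟩
    rw [dist_eq_norm]
    have h1 := hpar n n₀
    have h2 : 1 / ((n : ℝ) + 1) ≤ 1 / ((n₀ : ℝ) + 1) := Nat.one_div_le_one_div hn
    exact lt_of_pow_lt_pow_left₀ 2 hε.le (by linarith)
  obtain ⟨w, hw⟩ := cauchySeq_tendsto_of_complete hcau
  have hJlim : Tendsto (fun n => J (p n)) atTop (𝓝 m) := by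
    refine tendsto_of_tendsto_of_tendsto_of_le_of_le tendsto_const_nhds
      (by simpa using hinv.const_add m) (fun n => hmle _ (hpA n)) (fun n => (hpJ n).le)
  have halim : Tendsto (fun n => (p n).2) atTop (𝓝 (τ⁻¹ * (m - 1 / 2 * ‖w - z‖ ^ 2))) := by
    have h1 := (hJlim.sub ((((hw.sub_const z).norm).pow 2).const_mul (1 / 2))).const_mul τ⁻¹
    refine h1.congr fun n => ?_
    simp only [hJ]
    field_simp
    ring
  set a := τ⁻¹ * (m - 1 / 2 * ‖w - z‖ ^ 2) with ha
  have hfa : f w ≤ (a : EReal) := by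
    have hcl := hlsc.isClosed_epigraph
    have hlim : Tendsto (fun n => ((p n).1, (((p n).2 : ℝ) : EReal))) atTop (𝓝 (w, (a : EReal))) :=
      hw.prodMk_nhds ((continuous_coe_real_ereal.tendsto a).comp halim)
    exact hcl.mem_of_tendsto hlim (Eventually.of_forall fun n => hpA n)
  refine ⟨w, fun w' => ?_⟩
  by_cases hw' : f w' = ⊤
  · simp only [hw', EReal.coe_mul_top_of_pos hτ, EReal.coe_add_top]
    exact le_top
  obtain ⟨b, hb'⟩ := exists_coe_of_ne (hb w') hw'
  obtain ⟨d, hd⟩ := exists_coe_of_ne (hb w) (fun h => by rw [h] at hfa; simp at hfa)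
  have h1 := hmle (w', b) (by simp [hA, hb'])
  rw [hd] at hfa
  simp only [hd, hb']
  norm_cast at hfa ⊢
  have h2 : τ * d ≤ τ * a := mul_le_mul_of_nonneg_left hfa hτ.le
  rw [ha, mul_inv_cancel_left₀ hτ.ne'] at h2
  simp only [hJ] at h1
  linarith

/-- Each subgradient inequality places (x n, b - ⟪z n, y - x n⟫) in the epigraph of `f`, which is
closed. Any `y` with `f y` finite then bounds `f x₀`. -/
theorem mem_subdiff_of_tendsto {f : E → EReal} (hb : ∀ x, f x ≠ ⊥) (hlsc : LowerSemicontinuous f)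
    (ht : ∃ x, f x ≠ ⊤) {x z : ℕ → E} {x₀ z₀ : E} (hx : Tendsto x atTop (𝓝 x₀))
    (hz : Tendsto z atTop (𝓝 z₀)) (h : ∀ᶠ n in atTop, z n ∈ subdiff f (x n)) :
    z₀ ∈ subdiff f x₀ := by
  have key : ∀ y, ∀ b : ℝ, f y = b → f x₀ ≤ ((b - ⟪z₀, y - x₀⟫_ℝ : ℝ) : EReal) := by
    intro y b hy
    have hlim : Tendsto (fun n => (x n, ((b - ⟪z n, y - x n⟫_ℝ : ℝ) : EReal))) atTop
        (𝓝 (x₀, ((b - ⟪z₀, y - x₀⟫_ℝ : ℝ) : EReal))) :=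
      hx.prodMk_nhds ((continuous_coe_real_ereal.tendsto _).comp
        ((hz.inner (hx.const_sub y)).const_sub b))
    refine hlsc.isClosed_epigraph.mem_of_tendsto hlim ?_
    filter_upwards [h] with n hn
    obtain ⟨a, ha⟩ := exists_coe_of_ne (hb (x n)) hn.1
    have h1 := hn.2 y
    rw [ha, hy] at h1
    simp only [ha]
    norm_cast at h1 ⊢
    linarith
  have ht₀ : f x₀ ≠ ⊤ := by
    obtain ⟨y, hy⟩ := ht
    obtain ⟨b, hb'⟩ := exists_coe_of_ne (hb y) hy
    intro h'
    have := key y b hb'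
    rw [h'] at this
    exact EReal.coe_ne_top _ (top_le_iff.1 this)
  refine ⟨ht₀, fun y => ?_⟩
  by_cases hy : f y = ⊤
  · rw [hy]; exact le_top
  obtain ⟨b, hb'⟩ := exists_coe_of_ne (hb y) hy
  obtain ⟨a, ha⟩ := exists_coe_of_ne (hb x₀) ht₀
  have h1 := key y b hb'
  rw [ha] at h1 ⊢
  rw [hb']
  norm_cast at h1 ⊢
  linarith

theorem conj_le_coe_iff {f : E → EReal} (hb : ∀ x, f x ≠ ⊥) {p : E} {r : ℝ} :
    conj f p ≤ (r : EReal) ↔ ∀ y, ∀ b : ℝ, f y = b → ⟪p, y⟫_ℝ - b ≤ r := by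
  rw [conj, iSup_le_iff]
  refine forall_congr' fun y => ⟨fun h b hy => ?_, fun h => ?_⟩
  · rw [hy] at h
    exact_mod_cast h
  · by_cases hy : f y = ⊤
    · simp [hy]
    obtain ⟨b, hb'⟩ := exists_coe_of_ne (hb y) hy
    rw [hb']
    exact_mod_cast h b hb'

theorem conj_ne_bot {f : E → EReal} (hb : ∀ x, f x ≠ ⊥) (ht : ∃ x, f x ≠ ⊤) (p : E) :
    conj f p ≠ ⊥ := by
  obtain ⟨y, hy⟩ := ht
  obtain ⟨b, hb'⟩ := exists_coe_of_ne (hb y) hy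
  intro h
  have h1 := (conj_le_coe_iff hb (p := p) (r := ⟪p, y⟫_ℝ - b - 1)).1 (by rw [h]; exact bot_le) y b hb'
  linarith

theorem convex_epigraph_conj {f : E → EReal} (hb : ∀ x, f x ≠ ⊥) :
    Convex ℝ {p : E × ℝ | conj f p.1 ≤ (p.2 : EReal)} := by
  rintro ⟨p, r⟩ hp ⟨q, s⟩ hq a c ha hc hac
  simp only [Set.mem_ofPred_eq, conj_le_coe_iff hb, Prod.smul_mk, Prod.mk_add_mk] at hp hq ⊢
  intro y b hy
  have h1 := mul_le_mul_of_nonneg_left (hp y b hy) ha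
  have h2 := mul_le_mul_of_nonneg_left (hq y b hy) hc
  rw [inner_add_left, real_inner_smul_left, real_inner_smul_left, smul_eq_mul, smul_eq_mul]
  have h3 : b = a * b + c * b := by rw [← add_mul, hac, one_mul]
  linarith

theorem lowerSemicontinuous_conj {f : E → EReal} (hb : ∀ x, f x ≠ ⊥) :
    LowerSemicontinuous (conj f) := by
  refine lowerSemicontinuous_iSup fun y => Continuous.lowerSemicontinuous ?_
  by_cases hy : f y = ⊤
  · simp only [hy, EReal.sub_top]
    exact continuous_const
  obtain ⟨b, hb'⟩ := exists_coe_of_ne (hb y) hy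
  simp only [hb', ← EReal.coe_sub]
  exact continuous_coe_real_ereal.comp (by fun_prop)

end ConvexAnalysisLemmas

/-! ### Metric regularity with actual points instead of distances. -/

section MetricRegularityLemmas

variable {Q : Type*} [NormedAddCommGroup Q]

theorem IsRegularityModulus.exists_near {T : Q → Set Q} {w₀ q₀ : Q} {ℓ L : ℝ}
    (h : IsRegularityModulus T w₀ q₀ ℓ) (hL : ℓ < L) :
    ∃ r > 0, ∀ q w w', ‖q - q₀‖ ≤ r → ‖w - w₀‖ ≤ r → w' ∈ T q →
      ∃ p, w ∈ T p ∧ ‖q - p‖ ≤ L * ‖w - w'‖ := by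
  obtain ⟨hℓ, ρ, hρ, δ, hδ, h⟩ := h
  refine ⟨min ρ δ, lt_min hρ hδ, fun q w w' hq hw hw' => ?_⟩
  -- An almost nearest point requires a strict inequality, supplied by ℓ < L only if `w ≠ w'`;
  -- otherwise `q` itself serves.
  by_cases heq : w = w'
  · exact ⟨q, heq ▸ hw', by simp [heq]⟩
  have hpos : 0 < ‖w - w'‖ := norm_sub_pos_iff.2 heq
  have h1 := h q w (hq.trans (min_le_right _ _)) (hw.trans (min_le_left _ _))
  have h2 : Metric.infEDist q {p | w ∈ T p} < ENNReal.ofReal (L * ‖w - w'‖) := by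
    refine h1.trans_lt ((mul_le_mul_right (Metric.infEDist_le_edist_of_mem hw') _).trans_lt ?_)
    rw [edist_dist, dist_eq_norm, ← ENNReal.ofReal_mul hℓ.le]
    exact (ENNReal.ofReal_lt_ofReal_iff (by nlinarith)).2 (mul_lt_mul_of_pos_right hL hpos)
  obtain ⟨p, hp, hlt⟩ := Metric.infEDist_lt_iff.1 h2
  refine ⟨p, hp, ?_⟩
  rw [edist_dist, dist_eq_norm] at hlt
  exact (ENNReal.ofReal_lt_ofReal_iff_of_nonneg (norm_nonneg _)).1 hlt |>.le

end MetricRegularityLemmas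

/-! ### The norm of the preconditioner. -/

section EnergyNorm

variable {Q : Type*} [NormedAddCommGroup Q] [InnerProductSpace ℝ Q]

/-- The norm `√⟪M x, x⟫` induced by a positive symmetric operator `M`. -/
noncomputable def energyNorm (M : Q →ₗ[ℝ] Q) (x : Q) : ℝ := √⟪M x, x⟫_ℝ

theorem energyNorm_nonneg (M : Q →ₗ[ℝ] Q) (x : Q) : 0 ≤ energyNorm M x := Real.sqrt_nonneg _

theorem energyNorm_sq {M : Q →ₗ[ℝ] Q} (hpos : ∀ x, 0 ≤ ⟪M x, x⟫_ℝ) (x : Q) :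
    energyNorm M x ^ 2 = ⟪M x, x⟫_ℝ := Real.sq_sqrt (hpos x)

/-- Cauchy–Schwarz for the form of `M`, from the discriminant of t ↦ ⟪M(x + ty), x + ty⟫. -/
theorem inner_le_energyNorm_mul {M : Q →ₗ[ℝ] Q} (hpos : ∀ x, 0 ≤ ⟪M x, x⟫_ℝ)
    (hsymm : ∀ x y, ⟪M x, y⟫_ℝ = ⟪x, M y⟫_ℝ) (x y : Q) :
    ⟪M x, y⟫_ℝ ≤ energyNorm M x * energyNorm M y := by
  have h := discrim_le_zero (a := ⟪M y, y⟫_ℝ) (b := 2 * ⟪M x, y⟫_ℝ) (c := ⟪M x, x⟫_ℝ) fun t => by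
    have h1 := hpos (x + t • y)
    rw [map_add, map_smul, inner_add_left, inner_add_right, inner_add_right,
      real_inner_smul_left, real_inner_smul_left, real_inner_smul_right,
      real_inner_smul_right, hsymm y x, real_inner_comm (M x) y] at h1
    linarith
  rw [energyNorm, energyNorm, ← Real.sqrt_mul (hpos x)]
  refine Real.le_sqrt_of_sq_le ?_
  rw [discrim] at h
  nlinarith

theorem energyNorm_add_le {M : Q →ₗ[ℝ] Q} (hpos : ∀ x, 0 ≤ ⟪M x, x⟫_ℝ)
    (hsymm : ∀ x y, ⟪M x, y⟫_ℝ = ⟪x, M y⟫_ℝ) (x y : Q) :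
    energyNorm M (x + y) ≤ energyNorm M x + energyNorm M y := by
  refine abs_le_of_sq_le_sq' ?_ (add_nonneg (energyNorm_nonneg M x) (energyNorm_nonneg M y)) |>.2
  rw [energyNorm_sq hpos, map_add, inner_add_left, inner_add_right, inner_add_right, add_sq,
    energyNorm_sq hpos, energyNorm_sq hpos]
  have h1 := inner_le_energyNorm_mul hpos hsymm x y
  have h2 := inner_le_energyNorm_mul hpos hsymm y x
  linarith

theorem energyNorm_le {M : Q →ₗ[ℝ] Q} {Θ : ℝ} (hΘ : 0 ≤ Θ)
    (hup : ∀ x, ⟪M x, x⟫_ℝ ≤ Θ ^ 2 * ‖x‖ ^ 2) (x : Q) : energyNorm M x ≤ Θ * ‖x‖ := by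
  rw [energyNorm, Real.sqrt_le_left (by positivity), mul_pow]
  exact hup x

theorem le_energyNorm {M : Q →ₗ[ℝ] Q} {θ : ℝ}
    (hlow : ∀ x, θ ^ 2 * ‖x‖ ^ 2 ≤ ⟪M x, x⟫_ℝ) (x : Q) : θ * ‖x‖ ≤ energyNorm M x := by
  refine Real.le_sqrt_of_sq_le ?_
  rw [mul_pow]
  exact hlow x

theorem norm_apply_le_energyNorm {M : Q →ₗ[ℝ] Q} (hpos : ∀ x, 0 ≤ ⟪M x, x⟫_ℝ)
    (hsymm : ∀ x y, ⟪M x, y⟫_ℝ = ⟪x, M y⟫_ℝ) {Θ : ℝ} (hΘ : 0 ≤ Θ)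
    (hup : ∀ x, ⟪M x, x⟫_ℝ ≤ Θ ^ 2 * ‖x‖ ^ 2) (x : Q) : ‖M x‖ ≤ Θ * energyNorm M x := by
  have h1 := inner_le_energyNorm_mul hpos hsymm x (M x)
  rw [real_inner_self_eq_norm_sq] at h1
  have h2 := energyNorm_le hΘ hup (M x)
  have h3 := energyNorm_nonneg M x
  by_contra! hlt
  have h4 : 0 < ‖M x‖ := lt_of_le_of_lt (by positivity) hlt
  nlinarith [mul_le_mul_of_nonneg_left h2 h3]

end EnergyNorm

/-! ### Perturbed proximal steps under metric regularity. -/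

section LocalConvergence

variable {Q : Type*} [NormedAddCommGroup Q] [InnerProductSpace ℝ Q]

/-- The contraction factor of a perturbed proximal step under metric regularity. -/
noncomputable def contractionFactor (θ Θ L η ε : ℝ) : ℝ :=
  (L * Θ * (Θ + ε / θ) / √(1 + (L * Θ * (Θ + ε / θ)) ^ 2) + Θ * L * (η + ε) / θ) /
    √(1 - ε / θ ^ 2)

/-- A perturbed proximal step for a monotone map `T` contracts the distance, in the norm of the
preconditioner `M`, to a solution of the perturbed inclusion `-g q ∈ T p`. -/
theorem exists_contracted_solution {T : Q → Set Q} {g : Q → Q} {M : Q →ₗ[ℝ] Q}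
    {θ Θ L η ε r ρ : ℝ} {qhat : Q}
    (hT : ∀ q q' w w', w ∈ T q → w' ∈ T q' → 0 ≤ ⟪w - w', q - q'⟫_ℝ)
    (hsymm : ∀ x y, ⟪M x, y⟫_ℝ = ⟪x, M y⟫_ℝ) (hθ : 0 < θ) (hΘ : 0 < Θ)
    (hlow : ∀ x, θ ^ 2 * ‖x‖ ^ 2 ≤ ⟪M x, x⟫_ℝ) (hup : ∀ x, ⟪M x, x⟫_ℝ ≤ Θ ^ 2 * ‖x‖ ^ 2)
    (hL : 0 < L) (hη : 0 ≤ η) (hε : 0 < ε) (hεθ : ε < θ ^ 2)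
    (hreg : ∀ q w w', ‖q - qhat‖ ≤ ρ → ‖w‖ ≤ ρ → w' ∈ T q →
      ∃ p, w ∈ T p ∧ ‖q - p‖ ≤ L * ‖w - w'‖) (hrρ : (1 + 2 * (Θ / θ)) * r ≤ ρ)
    {q q' p h : Q} (hq' : ‖q' - qhat‖ ≤ r) (hp : ‖p - qhat‖ ≤ r)
    (hgq : ‖g q‖ ≤ ρ) (hgq' : ‖g q'‖ ≤ ρ) (hg : ‖g q' - g q‖ ≤ (η + ε) * ‖q' - q‖)
    (hpT : -g q ∈ T p) (hh : ‖h‖ ≤ ε * ‖q' - q‖) (hstep : -M (q' - q) - g q - h ∈ T q') :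
    ∃ p', -g q' ∈ T p' ∧
      energyNorm M (q' - p') ≤ contractionFactor θ Θ L η ε * energyNorm M (q - p) ∧
      ‖q' - q‖ ≤ (θ * √(1 - ε / θ ^ 2))⁻¹ * energyNorm M (q - p) := by
  have hpos : ∀ x, 0 ≤ ⟪M x, x⟫_ℝ := fun x => le_trans (by positivity) (hlow x)
  have hr : 0 ≤ r := (norm_nonneg _).trans hp
  have hr' : r ≤ ρ := by
    have : 0 ≤ 2 * (Θ / θ) * r := by positivity
    linarith
  set m := energyNorm M (q' - q) with hm
  set x := energyNorm M (q' - p) with hx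
  set y := energyNorm M (q - p) with hy
  set c := L * Θ * (Θ + ε / θ) with hc
  set b := √(1 - ε / θ ^ 2) with hbdef
  have hm0 : 0 ≤ m := energyNorm_nonneg M _
  have hx0 : 0 ≤ x := energyNorm_nonneg M _
  have hy0 : 0 ≤ y := energyNorm_nonneg M _
  have hc0 : 0 < c := by positivity
  have hβ : 0 < 1 - ε / θ ^ 2 := by
    rw [sub_pos, div_lt_one (by positivity)]
    exact hεθ
  have hb0 : 0 < b := Real.sqrt_pos.2 hβ
  have hb2 : b ^ 2 = 1 - ε / θ ^ 2 := Real.sq_sqrt hβ.le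
  have hΔ : θ * ‖q' - q‖ ≤ m := le_energyNorm hlow _
  have hΔ' : ‖q' - q‖ ≤ m / θ := by rwa [le_div_iff₀ hθ, mul_comm]
  have hxθ : θ * ‖q' - p‖ ≤ x := le_energyNorm hlow _
  have hxθ' : ‖q' - p‖ ≤ x / θ := by rwa [le_div_iff₀ hθ, mul_comm]
  -- Fejér estimate: monotonicity bounds the cross term of the three-point identity, and absorbing
  -- `h` costs the factor `b ^ 2`.
  have hfejer : b ^ 2 * (x ^ 2 + m ^ 2) ≤ y ^ 2 := by
    have h1 := hT _ _ _ _ hstep hpT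
    rw [show -M (q' - q) - g q - h - -g q = -M (q' - q) - h by abel, inner_sub_left,
      inner_neg_left] at h1
    have h2 : y ^ 2 = x ^ 2 + m ^ 2 - 2 * ⟪M (q' - q), q' - p⟫_ℝ := by
      have h3 : q - p = (q' - p) - (q' - q) := by abel
      rw [hy, hx, hm, energyNorm_sq hpos, energyNorm_sq hpos, energyNorm_sq hpos, h3]
      generalize q' - p = a
      generalize q' - q = d
      rw [map_sub, inner_sub_left, inner_sub_right, inner_sub_right, hsymm a d,
        real_inner_comm (M d) a]
      ring
    have h4 : -(ε / θ ^ 2 * (x * m)) ≤ ⟪h, q' - p⟫_ℝ := by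
      have h5 := (abs_le.1 (abs_real_inner_le_norm h (q' - p))).1
      have h6 : ‖h‖ * ‖q' - p‖ ≤ (ε * (m / θ)) * (x / θ) :=
        mul_le_mul (hh.trans (mul_le_mul_of_nonneg_left hΔ' hε.le)) hxθ' (norm_nonneg _)
          (by positivity)
      have h7 : (ε * (m / θ)) * (x / θ) = ε / θ ^ 2 * (x * m) := by field_simp
      linarith
    rw [hb2]
    have h8 : 0 ≤ ε / θ ^ 2 * (x - m) ^ 2 := by positivity
    nlinarith
  have hmy : b * m ≤ y := by
    refine abs_le_of_sq_le_sq' ?_ hy0 |>.2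
    nlinarith [mul_nonneg (sq_nonneg b) (sq_nonneg x)]
  have hmy' : m ≤ y / b := by rwa [le_div_iff₀ hb0, mul_comm]
  -- The new target for the old right-hand side satisfies both bounds `x` and `c * m`: keep `p` if
  -- it already does, otherwise metric regularity at `q'` provides one.
  obtain ⟨p₁, hp₁T, hp₁r, hp₁x, hp₁m⟩ : ∃ p₁, -g q ∈ T p₁ ∧
      ‖p₁ - qhat‖ ≤ ρ ∧ energyNorm M (q' - p₁) ≤ x ∧
      energyNorm M (q' - p₁) ≤ c * m := by
    by_cases hcase : x ≤ c * m
    · exact ⟨p, hpT, hp.trans hr', le_rfl, hcase⟩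
    rw [not_le] at hcase
    obtain ⟨p₁, hp₁T, hp₁⟩ := hreg q' (-g q) _ (hq'.trans hr') (by rw [norm_neg]; exact hgq)
      hstep
    have h1 : ‖-g q - (-M (q' - q) - g q - h)‖ ≤ (Θ + ε / θ) * m := by
      rw [show -g q - (-M (q' - q) - g q - h) = M (q' - q) + h by abel]
      refine (norm_add_le _ _).trans ?_
      have h2 := norm_apply_le_energyNorm hpos hsymm hΘ.le hup (q' - q)
      have h3 : ‖h‖ ≤ ε * (m / θ) := hh.trans (mul_le_mul_of_nonneg_left hΔ' hε.le)
      have h4 : ε * (m / θ) = ε / θ * m := by ring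
      rw [add_mul]
      linarith
    have h2 : energyNorm M (q' - p₁) ≤ c * m := by
      refine (energyNorm_le hΘ.le hup _).trans ?_
      calc Θ * ‖q' - p₁‖ ≤ Θ * (L * ((Θ + ε / θ) * m)) := by gcongr; exact hp₁.trans (by gcongr)
        _ = c * m := by rw [hc]; ring
    refine ⟨p₁, hp₁T, ?_, h2.trans hcase.le, h2⟩
    have h3 : ‖q' - p₁‖ ≤ x / θ := by
      rw [le_div_iff₀ hθ, mul_comm]
      exact (le_energyNorm hlow _).trans (h2.trans hcase.le)
    have h4 : ‖q' - p‖ ≤ 2 * r := by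
      rw [← sub_sub_sub_cancel_right q' p qhat]
      exact (norm_sub_le _ _).trans (by linarith)
    have h5 : x ≤ Θ * (2 * r) := (energyNorm_le hΘ.le hup _).trans (by gcongr)
    calc ‖p₁ - qhat‖ = ‖(q' - qhat) - (q' - p₁)‖ := by congr 1; abel
      _ ≤ ‖q' - qhat‖ + ‖q' - p₁‖ := norm_sub_le _ _
      _ ≤ r + Θ * (2 * r) / θ := by gcongr; exact h3.trans (by gcongr)
      _ = (1 + 2 * (Θ / θ)) * r := by ring
      _ ≤ ρ := hrρ
  set e := energyNorm M (q' - p₁) with he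
  have he0 : 0 ≤ e := energyNorm_nonneg M _
  have hs0 : 0 < √(1 + c ^ 2) := Real.sqrt_pos.2 (by positivity)
  have hey : e ≤ c / √(1 + c ^ 2) / b * y := by
    -- Weighting e ≤ x by c² and adding e ≤ c m turns the Fejér estimate into the factor c/√(1 +
    -- c²).
    have h1 : √(1 + c ^ 2) * b * e ≤ c * y := by
      refine abs_le_of_sq_le_sq' ?_ (by positivity) |>.2
      rw [mul_pow (√(1 + c ^ 2) * b) e, mul_pow (√(1 + c ^ 2)) b, mul_pow c y,
        Real.sq_sqrt (by positivity)]
      have h2 : c ^ 2 * e ^ 2 ≤ c ^ 2 * x ^ 2 := by gcongr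
      have h3 : e ^ 2 ≤ c ^ 2 * m ^ 2 := by rw [← mul_pow]; gcongr
      calc (1 + c ^ 2) * b ^ 2 * e ^ 2 = b ^ 2 * (e ^ 2 + c ^ 2 * e ^ 2) := by ring
        _ ≤ b ^ 2 * (c ^ 2 * m ^ 2 + c ^ 2 * x ^ 2) := by gcongr
        _ = c ^ 2 * (b ^ 2 * (x ^ 2 + m ^ 2)) := by ring
        _ ≤ c ^ 2 * y ^ 2 := by gcongr
    rw [div_div, div_mul_eq_mul_div, le_div_iff₀ (by positivity)]
    linarith
  -- Metric regularity once more, now at `p₁`, moves the target from `-g q` to `-g q'`.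
  obtain ⟨p₂, hp₂T, hp₂⟩ := hreg p₁ (-g q') _ hp₁r (by rw [norm_neg]; exact hgq') hp₁T
  refine ⟨p₂, hp₂T, ?_, ?_⟩
  · have h1 : ‖p₁ - p₂‖ ≤ L * ((η + ε) * (m / θ)) := by
      refine hp₂.trans (mul_le_mul_of_nonneg_left ?_ hL.le)
      rw [neg_sub_neg, norm_sub_rev]
      exact hg.trans (by gcongr)
    have h2 : energyNorm M (p₁ - p₂) ≤ Θ * L * (η + ε) / θ / b * y := by
      calc energyNorm M (p₁ - p₂) ≤ Θ * (L * ((η + ε) * (m / θ))) :=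
            (energyNorm_le hΘ.le hup _).trans (by gcongr)
        _ ≤ Θ * (L * ((η + ε) * (y / b / θ))) := by gcongr
        _ = Θ * L * (η + ε) / θ / b * y := by field_simp
    calc energyNorm M (q' - p₂) = energyNorm M ((q' - p₁) + (p₁ - p₂)) := by
          rw [sub_add_sub_cancel]
      _ ≤ e + energyNorm M (p₁ - p₂) := energyNorm_add_le hpos hsymm _ _
      _ ≤ c / √(1 + c ^ 2) / b * y + Θ * L * (η + ε) / θ / b * y := add_le_add hey h2
      _ = contractionFactor θ Θ L η ε * y := by rw [contractionFactor]; ring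
  · refine hΔ'.trans ?_
    calc m / θ ≤ y / b / θ := by gcongr
      _ = (θ * b)⁻¹ * y := by field_simp

theorem contractionFactor_nonneg {θ Θ L η ε : ℝ} (hθ : 0 < θ) (hΘ : 0 < Θ) (hL : 0 < L)
    (hη : 0 ≤ η) (hε : 0 < ε) : 0 ≤ contractionFactor θ Θ L η ε := by
  rw [contractionFactor]
  positivity

/-- Local convergence of perturbed proximal steps `Z q q'` for a metrically regular monotone
map `T`. -/
theorem exists_cauchySeq_of_steps {T : Q → Set Q} {g : Q → Q} {M : Q →ₗ[ℝ] Q} {Z : Q → Q → Prop}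
    {θ Θ L η ε r ρ : ℝ} {qhat : Q}
    (hT : ∀ q q' w w', w ∈ T q → w' ∈ T q' → 0 ≤ ⟪w - w', q - q'⟫_ℝ)
    (hsymm : ∀ x y, ⟪M x, y⟫_ℝ = ⟪x, M y⟫_ℝ) (hθ : 0 < θ) (hΘ : 0 < Θ)
    (hlow : ∀ x, θ ^ 2 * ‖x‖ ^ 2 ≤ ⟪M x, x⟫_ℝ) (hup : ∀ x, ⟪M x, x⟫_ℝ ≤ Θ ^ 2 * ‖x‖ ^ 2)
    (hL : 0 < L) (hη : 0 ≤ η) (hε : 0 < ε) (hεθ : ε < θ ^ 2)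
    (hfactor : contractionFactor θ Θ L η ε < 1)
    (hreg : ∀ q w w', ‖q - qhat‖ ≤ ρ → ‖w‖ ≤ ρ → w' ∈ T q →
      ∃ p, w ∈ T p ∧ ‖q - p‖ ≤ L * ‖w - w'‖) (hr : 0 < r) (hrρ : (1 + 2 * (Θ / θ)) * r ≤ ρ)
    (hgρ : (η + ε) * r ≤ ρ) (h0 : 0 ∈ T qhat) (hg0 : g qhat = 0)
    (hg : ∀ q q', ‖q - qhat‖ ≤ r → ‖q' - qhat‖ ≤ r → ‖g q' - g q‖ ≤ (η + ε) * ‖q' - q‖)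
    (hstep : ∀ q q', ‖q - qhat‖ ≤ r → ‖q' - qhat‖ ≤ r → Z q q' →
      ∃ h, ‖h‖ ≤ ε * ‖q' - q‖ ∧ -M (q' - q) - g q - h ∈ T q')
    (hcont : ∃ r₁ > 0, ∀ q q', ‖q - qhat‖ ≤ r₁ → Z q q' → ‖q' - qhat‖ ≤ r) :
    ∃ δ > 0, ∀ q : ℕ → Q, ‖q 0 - qhat‖ ≤ δ → (∀ i, Z (q i) (q (i + 1))) → CauchySeq q := by
  obtain ⟨r₁, hr₁, hcont⟩ := hcont
  have hgnorm : ∀ x, ‖x - qhat‖ ≤ r → ‖g x‖ ≤ (η + ε) * ‖x - qhat‖ := fun x hx => by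
    have := hg qhat x (by simpa using hr.le) hx
    rwa [hg0, sub_zero] at this
  have hgnorm' : ∀ x, ‖x - qhat‖ ≤ r → ‖g x‖ ≤ ρ := fun x hx =>
    (hgnorm x hx).trans (le_trans (by gcongr) hgρ)
  have hρ : 0 ≤ ρ := (norm_nonneg _).trans (hgnorm' qhat (by simpa using hr.le))
  have hΛ0 := contractionFactor_nonneg hθ hΘ hL hη hε
  set Λ := contractionFactor θ Θ L η ε with hΛ
  have hβ : 0 < √(1 - ε / θ ^ 2) := by
    rw [Real.sqrt_pos, sub_pos, div_lt_one (by positivity)]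
    exact hεθ
  set C := (θ * √(1 - ε / θ ^ 2))⁻¹ with hC
  have hC0 : 0 < C := by positivity
  set A := Θ * (1 + L * (η + ε)) with hA
  have hA0 : 0 < A := by positivity
  have hΛ1 : 0 < 1 - Λ := sub_pos.2 hfactor
  set B := 1 + C * A / (1 - Λ) with hB
  have hB0 : 0 < B := by positivity
  -- `A * δ` bounds the initial energy distance to a target, and `δ * B` the total displacement over
  -- all steps. Iterates and targets each use half of `r`, so both remain in the ball of radius `r`.
  set δ := min (min r₁ (r / 2) / B) (r / 2 * θ / A) with hδ
  have hδ0 : 0 < δ := by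
    have : 0 < min r₁ (r / 2) := lt_min hr₁ (by positivity)
    rw [hδ]
    positivity
  have hδB : δ * B ≤ min r₁ (r / 2) := by
    rw [← le_div_iff₀ hB0]
    exact min_le_left _ _
  have hδA : A * δ ≤ r / 2 * θ := by
    rw [mul_comm, ← le_div_iff₀ hA0]
    exact min_le_right _ _
  have hδr : δ ≤ r := by
    have h1 : δ * 1 ≤ δ * B := by
      gcongr
      rw [hB, le_add_iff_nonneg_right]
      positivity
    linarith [hδB.trans (min_le_right _ _)]
  refine ⟨δ, hδ0, fun q hq0 hZ => ?_⟩
  have hbound : ∀ i : ℕ, δ + C * (A * δ) * ((1 - Λ ^ i) / (1 - Λ)) ≤ min r₁ (r / 2) := by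
    intro i
    refine le_trans ?_ hδB
    have h1 : (1 - Λ ^ i) / (1 - Λ) ≤ 1 / (1 - Λ) := by
      gcongr
      linarith [pow_nonneg hΛ0 i]
    calc δ + C * (A * δ) * ((1 - Λ ^ i) / (1 - Λ)) ≤ δ + C * (A * δ) * (1 / (1 - Λ)) := by gcongr
      _ = δ * B := by rw [hB]; ring
  have hone : ∀ i, ∀ p, -g (q i) ∈ T p → energyNorm M (q i - p) ≤ Λ ^ i * (A * δ) →
      ‖q i - qhat‖ ≤ min r₁ (r / 2) → ∃ p', -g (q (i + 1)) ∈ T p' ∧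
        energyNorm M (q (i + 1) - p') ≤ Λ ^ (i + 1) * (A * δ) ∧
        ‖q (i + 1) - q i‖ ≤ C * (A * δ) * Λ ^ i := by
    intro i p hpT hpi hqi
    have hqr : ‖q i - qhat‖ ≤ r := by linarith [hqi.trans (min_le_right _ _)]
    have hq'r := hcont _ _ (hqi.trans (min_le_left _ _)) (hZ i)
    have hpr : ‖p - qhat‖ ≤ r := by
      have h1 : θ * ‖q i - p‖ ≤ θ * (r / 2) := by
        refine (le_energyNorm hlow _).trans (hpi.trans ?_)
        calc Λ ^ i * (A * δ) ≤ 1 * (A * δ) := by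
              gcongr
              exact pow_le_one₀ hΛ0 hfactor.le
          _ ≤ θ * (r / 2) := by linarith
      have h2 := le_of_mul_le_mul_left h1 hθ
      calc ‖p - qhat‖ = ‖(q i - qhat) - (q i - p)‖ := by congr 1; abel
        _ ≤ ‖q i - qhat‖ + ‖q i - p‖ := norm_sub_le _ _
        _ ≤ r := by linarith [hqi.trans (min_le_right _ _)]
    obtain ⟨h, hh, hhT⟩ := hstep _ _ hqr hq'r (hZ i)
    obtain ⟨p', hp'T, hp', hdist⟩ := exists_contracted_solution hT hsymm hθ hΘ hlow hup hL hη hε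
      hεθ hreg hrρ hq'r hpr (hgnorm' _ hqr) (hgnorm' _ hq'r) (hg _ _ hqr hq'r) hpT hh hhT
    refine ⟨p', hp'T, hp'.trans ?_, hdist.trans ?_⟩
    · calc Λ * energyNorm M (q i - p) ≤ Λ * (Λ ^ i * (A * δ)) := by gcongr
        _ = Λ ^ (i + 1) * (A * δ) := by ring
    · calc C * energyNorm M (q i - p) ≤ C * (Λ ^ i * (A * δ)) := by gcongr
        _ = C * (A * δ) * Λ ^ i := by ring
  have hind : ∀ i, ∃ p, -g (q i) ∈ T p ∧ energyNorm M (q i - p) ≤ Λ ^ i * (A * δ) ∧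
      ‖q i - qhat‖ ≤ δ + C * (A * δ) * ((1 - Λ ^ i) / (1 - Λ)) := by
    intro i
    induction i with
    | zero =>
      have hqr := hq0.trans hδr
      obtain ⟨p, hpT, hp⟩ := hreg qhat (-g (q 0)) 0 (by simpa using hρ)
        (by rw [norm_neg]; exact hgnorm' _ hqr) h0
      refine ⟨p, hpT, ?_, by simpa using hq0⟩
      rw [sub_zero, norm_neg] at hp
      have h1 : ‖q 0 - p‖ ≤ δ + L * ((η + ε) * δ) := by
        rw [← sub_add_sub_cancel (q 0) qhat p]
        refine (norm_add_le _ _).trans (add_le_add hq0 (hp.trans ?_))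
        gcongr
        exact (hgnorm _ hqr).trans (by gcongr)
      calc energyNorm M (q 0 - p) ≤ Θ * (δ + L * ((η + ε) * δ)) :=
            (energyNorm_le hΘ.le hup _).trans (by gcongr)
        _ = Λ ^ 0 * (A * δ) := by rw [hA]; ring
    | succ i ih =>
      obtain ⟨p, hpT, hpi, hqi⟩ := ih
      obtain ⟨p', hp'T, hp', hdist⟩ := hone i p hpT hpi (hqi.trans (hbound i))
      refine ⟨p', hp'T, hp', ?_⟩
      calc ‖q (i + 1) - qhat‖ = ‖(q (i + 1) - q i) + (q i - qhat)‖ := by congr 1; abel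
        _ ≤ C * (A * δ) * Λ ^ i + (δ + C * (A * δ) * ((1 - Λ ^ i) / (1 - Λ))) :=
          (norm_add_le _ _).trans (add_le_add hdist hqi)
        _ = δ + C * (A * δ) * ((1 - Λ ^ (i + 1)) / (1 - Λ)) := by
          field_simp
          ring
  refine cauchySeq_of_le_geometric Λ (C * (A * δ)) hfactor fun i => ?_
  obtain ⟨p, hpT, hpi, hqi⟩ := hind i
  obtain ⟨_, _, _, hdist⟩ := hone i p hpT hpi (hqi.trans (hbound i))
  rwa [dist_comm, dist_eq_norm]

/-- At ε = 0 the factor is ℓΘ²/√(1 + ℓ²Θ⁴) + ℓ(Θ/θ)η. Its first term equals 1/√(1 + 1/(ℓ²Θ⁴)) for ℓ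
> 0, which the constant 2 in the hypothesis only enlarges. Continuity in ε does the rest. -/
theorem exists_contractionFactor_lt_one {θ Θ ℓ η : ℝ} (hθ : 0 < θ) (hΘ : 0 < Θ) (hℓ : 0 ≤ ℓ)
    (hsmall : 0 < ℓ → ℓ * (Θ / θ) * η < 1 - 1 / √(1 + 1 / (2 * ℓ ^ 2 * Θ ^ 4))) :
    ∃ ε > 0, ε < θ ^ 2 ∧ contractionFactor θ Θ (ℓ + ε) η ε < 1 := by
  have h0 : contractionFactor θ Θ (ℓ + 0) η 0 < 1 := by
    have hc : contractionFactor θ Θ (ℓ + 0) η 0 =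
        ℓ * Θ ^ 2 / √(1 + (ℓ * Θ ^ 2) ^ 2) + ℓ * (Θ / θ) * η := by
      simp only [contractionFactor, add_zero, zero_div, sub_zero, Real.sqrt_one, div_one]
      rw [show ℓ * Θ * Θ = ℓ * Θ ^ 2 by ring]
      ring
    rw [hc]
    rcases hℓ.eq_or_lt with rfl | hℓ
    · simp
    · have h1 := hsmall hℓ
      have h2 : ℓ * Θ ^ 2 / √(1 + (ℓ * Θ ^ 2) ^ 2) ≤ 1 / √(1 + 1 / (2 * ℓ ^ 2 * Θ ^ 4)) := by
        rw [div_le_div_iff₀ (by positivity) (by positivity), one_mul]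
        refine Real.le_sqrt_of_sq_le ?_
        rw [mul_pow, Real.sq_sqrt (by positivity)]
        have h3 : (ℓ * Θ ^ 2) ^ 2 * (1 + 1 / (2 * ℓ ^ 2 * Θ ^ 4)) = (ℓ * Θ ^ 2) ^ 2 + 1 / 2 := by
          field_simp
        rw [h3]
        linarith
      linarith
  have hcont : ContinuousAt (fun ε => contractionFactor θ Θ (ℓ + ε) η ε) 0 := by
    unfold contractionFactor
    have h1 : ∀ x : ℝ, √(1 + x ^ 2) ≠ 0 := fun x => (Real.sqrt_pos.2 (by positivity)).ne'
    refine ContinuousAt.div (ContinuousAt.add (ContinuousAt.div ?_ ?_ (h1 _)) ?_) ?_ (by simp)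
    all_goals fun_prop
  have h1 : ∀ᶠ ε in 𝓝[>] (0 : ℝ), contractionFactor θ Θ (ℓ + ε) η ε < 1 :=
    (hcont.eventually_lt_const h0).filter_mono nhdsWithin_le_nhds
  obtain ⟨ε, hε, hε'⟩ := (h1.and (Ioo_mem_nhdsGT (show 0 < θ ^ 2 by positivity))).exists
  exact ⟨ε, hε'.1, hε'.2, hε⟩

end LocalConvergence

section ProductNorm

variable {X Y : Type*} [NormedAddCommGroup X] [NormedAddCommGroup Y]

theorem norm_le_norm_fst_add_norm_snd (q : WithLp 2 (X × Y)) : ‖q‖ ≤ ‖q.fst‖ + ‖q.snd‖ := by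
  refine abs_le_of_sq_le_sq' ?_ (by positivity) |>.2
  rw [WithLp.prod_norm_sq_eq_of_L2]
  nlinarith [mul_nonneg (norm_nonneg q.fst) (norm_nonneg q.snd)]

end ProductNorm

theorem exists_seq_of_forall_exists {α : Type*} {P : ℕ → α → α → Prop}
    (h : ∀ i a, ∃ b, P i a b) (a₀ : α) : ∃ q : ℕ → α, q 0 = a₀ ∧ ∀ i, P i (q i) (q (i + 1)) := by
  choose next hnext using h
  exact ⟨fun n => Nat.rec a₀ (fun i a => next i a) n, rfl, fun i => hnext i _⟩

theorem norm_sub_sub_fderiv_le {X Y : Type*} [NormedAddCommGroup X] [NormedSpace ℝ X]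
    [NormedAddCommGroup Y] [NormedSpace ℝ Y] {K : X → Y} (hK : Differentiable ℝ K) {L r : ℝ} {b : X}
    (hL : ∀ x ∈ Metric.closedBall b r, ‖fderiv ℝ K x - fderiv ℝ K b‖ ≤ L * r)
    {x y : X} (hx : x ∈ Metric.closedBall b r) (hy : y ∈ Metric.closedBall b r) :
    ‖K y - K x - fderiv ℝ K b (y - x)‖ ≤ L * r * ‖y - x‖ :=
  (convex_closedBall b r).norm_image_sub_le_of_norm_fderiv_le' (fun z _ => hK z) hL hx hy

/-! ### Positivity and eventual constancy of the step lengths. -/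

section StepLengths

variable {μ : ℝ} {N : ℕ} {τ σ ω : ℕ → ℝ}

theorem IsPrimalAcceleration.omega_pos_of_tau_pos (hrule : IsPrimalAcceleration μ N τ σ ω)
    (hμ : 0 ≤ μ) {i : ℕ} (hi : 0 < τ i) : 0 < ω i := by
  rcases lt_or_ge i N with hN | hN
  · rw [hrule.omega_accel i hN]
    positivity
  · rw [hrule.omega_stop i hN]
    exact one_pos

theorem IsPrimalAcceleration.tau_pos' (hrule : IsPrimalAcceleration μ N τ σ ω) (hμ : 0 ≤ μ) (i : ℕ) :
    0 < τ i := by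
  induction i with
  | zero => exact hrule.tau_pos
  | succ i ih =>
    rw [hrule.tau_succ]
    exact mul_pos (hrule.omega_pos_of_tau_pos hμ ih) ih

theorem IsPrimalAcceleration.sigma_pos' (hrule : IsPrimalAcceleration μ N τ σ ω) (hμ : 0 ≤ μ) (i : ℕ) :
    0 < σ i := by
  induction i with
  | zero => exact hrule.sigma_pos
  | succ i ih =>
    rw [hrule.sigma_succ]
    exact div_pos ih (hrule.omega_pos_of_tau_pos hμ (hrule.tau_pos' hμ i))

theorem IsPrimalAcceleration.tau_eq (hrule : IsPrimalAcceleration μ N τ σ ω) (i : ℕ) :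
    τ (N + i) = τ N := by
  induction i with
  | zero => rfl
  | succ i ih => rw [← add_assoc, hrule.tau_succ, hrule.omega_stop _ (by omega), one_mul, ih]

theorem IsPrimalAcceleration.sigma_eq (hrule : IsPrimalAcceleration μ N τ σ ω) (i : ℕ) :
    σ (N + i) = σ N := by
  induction i with
  | zero => rfl
  | succ i ih => rw [← add_assoc, hrule.sigma_succ, hrule.omega_stop _ (by omega), div_one, ih]

end StepLengths

/-! ### Primal-dual steps as perturbed proximal steps. -/

section Steps

variable {X Y : Type*} [NormedAddCommGroup X] [InnerProductSpace ℝ X] [CompleteSpace X]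
  [NormedAddCommGroup Y] [InnerProductSpace ℝ Y] [CompleteSpace Y]

/-- One step of the primal-dual extragradient method with step lengths `τ`, `σ` and
extrapolation parameter `ω`. -/
def IsStep (K : X → Y) (G : X → EReal) (F : Y → EReal) (τ σ ω : ℝ) (q q' : WithLp 2 (X × Y)) :
    Prop :=
  IsProx (fun u => (τ : EReal) * G u) (q.fst - τ • gradAdj K q.fst q.snd) q'.fst ∧
    IsProx (fun v => (σ : EReal) * conj F v)
      (q.snd + σ • K (q'.fst + ω • (q'.fst - q.fst))) q'.snd

variable {K : X → Y} {G : X → EReal} {F : Y → EReal}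

theorem IsIterateSeq.isStep {τ σ ω : ℕ → ℝ} {s : ℕ} {q : ℕ → WithLp 2 (X × Y)}
    (h : IsIterateSeq K G F τ σ ω s q) (i : ℕ) :
    IsStep K G F (τ i) (σ (i + s)) (ω i) (q i) (q (i + 1)) :=
  ⟨h.primal i, h.dual i⟩

theorem exists_isIterateSeq {τ σ ω : ℕ → ℝ} {s : ℕ}
    (h : ∀ i q, ∃ q', IsStep K G F (τ i) (σ (i + s)) (ω i) q q') (q₀ : WithLp 2 (X × Y)) :
    ∃ q : ℕ → WithLp 2 (X × Y), q 0 = q₀ ∧ IsIterateSeq K G F τ σ ω s q := by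
  obtain ⟨q, hq, hstep⟩ := exists_seq_of_forall_exists h q₀
  exact ⟨q, hq, fun i => (hstep i).1, fun i => (hstep i).2⟩

theorem exists_isStep (hG : IsConvexFunctional G) (hF : IsConvexFunctional F)
    {qhat : WithLp 2 (X × Y)} (hcrit : IsCriticalPoint K G F qhat) {τ σ : ℝ} (hτ : 0 < τ)
    (hσ : 0 < σ) (ω : ℝ) (q : WithLp 2 (X × Y)) : ∃ q', IsStep K G F τ σ ω q q' := by
  obtain ⟨u, hu⟩ := exists_isProx hG.convex_epigraph hG.ne_bot hG.lsc hcrit.2 hτ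
    (q.fst - τ • gradAdj K q.fst q.snd)
  obtain ⟨v, hv⟩ := exists_isProx (convex_epigraph_conj hF.ne_bot)
    (conj_ne_bot hF.ne_bot hF.exists_ne_top) (lowerSemicontinuous_conj hF.ne_bot) hcrit.1 hσ
    (q.snd + σ • K (u + ω • (u - q.fst)))
  exact ⟨WithLp.toLp 2 (u, v), hu, hv⟩

theorem IsStep.primal_mem_subdiff (hG : IsConvexFunctional G) {τ σ ω : ℝ} (hτ : 0 < τ)
    {q q' : WithLp 2 (X × Y)} (h : IsStep K G F τ σ ω q q') :
    τ⁻¹ • (q.fst - τ • gradAdj K q.fst q.snd - q'.fst) ∈ subdiff G q'.fst :=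
  h.1.mem_subdiff hG.convex_epigraph hG.ne_bot hG.exists_ne_top hτ

theorem IsStep.dual_mem_subdiff (hF : IsConvexFunctional F) {qhat : WithLp 2 (X × Y)}
    (hcrit : IsCriticalPoint K G F qhat) {τ σ ω : ℝ} (hσ : 0 < σ)
    {q q' : WithLp 2 (X × Y)} (h : IsStep K G F τ σ ω q q') :
    σ⁻¹ • (q.snd + σ • K (q'.fst + ω • (q'.fst - q.fst)) - q'.snd) ∈ subdiff (conj F) q'.snd :=
  h.2.mem_subdiff (convex_epigraph_conj hF.ne_bot) (conj_ne_bot hF.ne_bot hF.exists_ne_top)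
    ⟨_, hcrit.1.1⟩ hσ

theorem continuous_gradAdj (hK' : Continuous (fderiv ℝ K)) : Continuous (gradAdj K) :=
  (ContinuousLinearMap.adjoint (𝕜 := ℝ) (E := X) (F := Y)).continuous.comp hK'

theorem norm_gradAdj_sub (x y : X) :
    ‖gradAdj K x - gradAdj K y‖ = ‖fderiv ℝ K x - fderiv ℝ K y‖ := by
  rw [gradAdj, gradAdj, ← map_sub, LinearIsometryEquiv.norm_map]

theorem inner_gradAdj (u : X) (v : Y) (x : X) :
    ⟪gradAdj K u v, x⟫_ℝ = ⟪v, fderiv ℝ K u x⟫_ℝ :=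
  ContinuousLinearMap.adjoint_inner_left _ _ _

/-- The prox is nonexpansive and `qhat` is a fixed point, so the displacement is controlled by that
of the continuous prox arguments `φ` and `ψ`. -/
theorem eventually_isStep_near (hG : IsConvexFunctional G) (hF : IsConvexFunctional F)
    (hK : Continuous K) (hK' : Continuous (fderiv ℝ K)) {qhat : WithLp 2 (X × Y)}
    (hcrit : IsCriticalPoint K G F qhat) {τ σ : ℝ} (hτ : 0 < τ) (hσ : 0 < σ) (ω : ℝ) {ε : ℝ}
    (hε : 0 < ε) : ∀ᶠ q in 𝓝 qhat, ∀ q', IsStep K G F τ σ ω q q' → ‖q' - qhat‖ ≤ ε := by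
  have hadj := continuous_gradAdj hK'
  have hfst : Continuous fun q : WithLp 2 (X × Y) => q.fst := by fun_prop
  have hsnd : Continuous fun q : WithLp 2 (X × Y) => q.snd := by fun_prop
  set φ : WithLp 2 (X × Y) → X := fun q => q.fst - τ • gradAdj K q.fst q.snd with hφ
  set ψ : WithLp 2 (X × Y) × X → Y := fun p => p.1.snd + σ • K (p.2 + ω • (p.2 - p.1.fst)) with hψ
  have hφc : Continuous φ :=
    hfst.sub (((hadj.comp hfst).clm_apply hsnd).const_smul τ)
  have hψc : Continuous ψ := by fun_prop
  have hu : ∀ q q', IsStep K G F τ σ ω q q' → ‖q'.fst - qhat.fst‖ ≤ ‖φ q - φ qhat‖ := by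
    intro q q' h
    refine norm_sub_le_of_mem_subdiff hG.ne_bot hτ (h.primal_mem_subdiff hG hτ) ?_
    convert hcrit.2 using 1
    rw [hφ, sub_right_comm, sub_self, zero_sub, smul_neg, inv_smul_smul₀ hτ.ne']
  have hv : ∀ q q', IsStep K G F τ σ ω q q' →
      ‖q'.snd - qhat.snd‖ ≤ ‖ψ (q, q'.fst) - ψ (qhat, qhat.fst)‖ := by
    intro q q' h
    refine norm_sub_le_of_mem_subdiff (conj_ne_bot hF.ne_bot hF.exists_ne_top) hσ
      (h.dual_mem_subdiff hF hcrit hσ) ?_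
    convert hcrit.1 using 1
    simp only [hψ, sub_self, smul_zero, add_zero, add_sub_cancel_left, inv_smul_smul₀ hσ.ne']
  have hψε : ∀ᶠ p in 𝓝 (qhat, qhat.fst), ‖ψ p - ψ (qhat, qhat.fst)‖ < ε / 2 :=
    (hψc.sub continuous_const).norm.continuousAt.eventually_lt_const (by
      change ‖ψ (qhat, qhat.fst) - ψ (qhat, qhat.fst)‖ < _
      rw [sub_self (ψ (qhat, qhat.fst)), norm_zero]
      exact half_pos hε)
  rw [nhds_prod_eq, Filter.eventually_prod_iff] at hψε
  obtain ⟨P, hP, P', hP', hPP'⟩ := hψε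
  obtain ⟨d, hd, hdP'⟩ := Metric.eventually_nhds_iff.1 hP'
  have hφε : ∀ᶠ q in 𝓝 qhat, ‖φ q - φ qhat‖ < min d (ε / 2) :=
    (hφc.sub continuous_const).norm.continuousAt.eventually_lt_const
      (by
        change ‖φ qhat - φ qhat‖ < _
        rw [sub_self (φ qhat), norm_zero]
        exact lt_min hd (half_pos hε))
  filter_upwards [hP, hφε] with q hq hq' q' h
  have h1 := (hu q q' h).trans_lt hq'
  have h2 := hPP' hq (hdP' (y := q'.fst) (by rw [dist_eq_norm]; exact h1.trans_le (min_le_left _ _)))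
  have h3 := hv q q' h
  have h4 := norm_le_norm_fst_add_norm_snd (q' - qhat)
  rw [WithLp.sub_fst, WithLp.sub_snd] at h4
  linarith [h1.le.trans (min_le_right _ _)]

theorem eventually_iterate_near (hG : IsConvexFunctional G) (hF : IsConvexFunctional F)
    (hK : Continuous K) (hK' : Continuous (fderiv ℝ K)) {qhat : WithLp 2 (X × Y)}
    (hcrit : IsCriticalPoint K G F qhat) {τ σ ω : ℕ → ℝ} (hτ : ∀ i, 0 < τ i) (hσ : ∀ i, 0 < σ i)
    (s n : ℕ) : ∀ ε > 0, ∀ᶠ q₀ in 𝓝 qhat, ∀ q : ℕ → WithLp 2 (X × Y), q 0 = q₀ →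
      IsIterateSeq K G F τ σ ω s q → ‖q n - qhat‖ ≤ ε := by
  induction n with
  | zero =>
    intro ε hε
    filter_upwards [Metric.closedBall_mem_nhds qhat hε] with q₀ hq₀ q hq _
    rwa [hq, ← mem_closedBall_iff_norm]
  | succ n ih =>
    intro ε hε
    obtain ⟨d, hd, hdist⟩ := Metric.nhds_basis_closedBall.eventually_iff.1
      (eventually_isStep_near hG hF hK hK' hcrit (hτ n) (hσ (n + s)) (ω n) hε)
    filter_upwards [ih d hd] with q₀ hq₀ q hq hiter
    exact hdist (mem_closedBall_iff_norm.2 (hq₀ q hq hiter)) _ (hiter.isStep n)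

theorem isCriticalPoint_of_tendsto (hG : IsConvexFunctional G) (hF : IsConvexFunctional F)
    (hK : Continuous K) (hK' : Continuous (fderiv ℝ K)) {qhat qstar : WithLp 2 (X × Y)}
    (hcrit : IsCriticalPoint K G F qhat) {τ σ : ℝ} (hτ : 0 < τ) (hσ : 0 < σ)
    {ω : ℝ} {q : ℕ → WithLp 2 (X × Y)} (h : ∀ i, IsStep K G F τ σ ω (q i) (q (i + 1)))
    (hq : Tendsto q atTop (𝓝 qstar)) : IsCriticalPoint K G F qstar := by
  have hfst : Continuous fun q : WithLp 2 (X × Y) => q.fst := by fun_prop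
  have hsnd : Continuous fun q : WithLp 2 (X × Y) => q.snd := by fun_prop
  have hu := (hfst.tendsto qstar).comp hq
  have hv := (hsnd.tendsto qstar).comp hq
  have hu' := hu.comp (tendsto_add_atTop_nat 1)
  have hv' := hv.comp (tendsto_add_atTop_nat 1)
  refine ⟨mem_subdiff_of_tendsto (conj_ne_bot hF.ne_bot hF.exists_ne_top)
    (lowerSemicontinuous_conj hF.ne_bot) ⟨_, hcrit.1.1⟩ hv' ?_
    (Eventually.of_forall fun i => (h i).dual_mem_subdiff hF hcrit hσ),
    mem_subdiff_of_tendsto hG.ne_bot hG.lsc hG.exists_ne_top hu' ?_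
    (Eventually.of_forall fun i => (h i).primal_mem_subdiff hG hτ)⟩
  · have hlim := ((hv.add (((hK.tendsto _).comp
      (hu'.add ((hu'.sub hu).const_smul ω))).const_smul σ)).sub hv').const_smul σ⁻¹
    refine (congrArg (fun z => Tendsto _ atTop (𝓝 z)) ?_).mp hlim
    rw [sub_self, smul_zero, add_zero, add_sub_cancel_left, inv_smul_smul₀ hσ.ne']
  · have hadj := (((continuous_gradAdj hK').comp hfst).clm_apply hsnd).tendsto qstar |>.comp hq
    have hlim := ((hu.sub (hadj.const_smul τ)).sub hu').const_smul τ⁻¹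
    refine (congrArg (fun z => Tendsto _ atTop (𝓝 z)) ?_).mp hlim
    rw [sub_right_comm, sub_self, zero_sub, smul_neg, inv_smul_smul₀ hτ.ne']
    rfl

/-- The preconditioner as a linear map. -/
noncomputable def precondLinear (K : X → Y) (τ σ : ℝ) (u : X) : WithLp 2 (X × Y) →ₗ[ℝ] WithLp 2 (X × Y) where
  toFun := precond K τ σ u
  map_add' p q := by
    refine (WithLp.equiv 2 (X × Y)).injective (Prod.ext ?_ ?_) <;>
      simp [precond] <;> abel
  map_smul' c q := by
    refine (WithLp.equiv 2 (X × Y)).injective (Prod.ext ?_ ?_) <;>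
      simp [precond, smul_sub, smul_add, smul_comm c]

theorem precondLinear_symm (τ σ : ℝ) (u : X) (p q : WithLp 2 (X × Y)) :
    ⟪precondLinear K τ σ u p, q⟫_ℝ = ⟪p, precondLinear K τ σ u q⟫_ℝ := by
  change ⟪precond K τ σ u p, q⟫_ℝ = ⟪p, precond K τ σ u q⟫_ℝ
  simp only [precond, WithLp.prod_inner_apply, inner_sub_left, inner_sub_right, inner_add_left,
    inner_add_right, inner_neg_left, inner_neg_right, real_inner_smul_left,
    real_inner_smul_right]
  have h1 := inner_gradAdj (K := K) u p.snd q.fst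
  have h2 := inner_gradAdj (K := K) u q.snd p.fst
  rw [real_inner_comm, real_inner_comm (fderiv ℝ K u p.fst)] at h2
  simp only [WithLp.ofLp_fst, WithLp.ofLp_snd]
  linarith

theorem H_monotone (hG : IsConvexFunctional G) (hF : IsConvexFunctional F) (b : X)
    (q q' w w' : WithLp 2 (X × Y)) (hw : w ∈ H K G F b q) (hw' : w' ∈ H K G F b q') :
    0 ≤ ⟪w - w', q - q'⟫_ℝ := by
  have h1 := subdiff_monotone hG.ne_bot hw.1 hw'.1
  have h2 := subdiff_monotone (conj_ne_bot hF.ne_bot hF.exists_ne_top) hw.2 hw'.2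
  rw [show w.fst - gradAdj K b q.snd - (w'.fst - gradAdj K b q'.snd)
      = (w.fst - w'.fst) - gradAdj K b (q.snd - q'.snd) by rw [map_sub]; abel, inner_sub_left,
    inner_gradAdj] at h1
  rw [add_sub_add_right_eq_sub, show w.snd + fderiv ℝ K b q.fst - (w'.snd + fderiv ℝ K b q'.fst)
      = (w.snd - w'.snd) + fderiv ℝ K b (q.fst - q'.fst) by rw [map_sub]; abel, inner_add_left,
    real_inner_comm (q.snd - q'.snd) (fderiv ℝ K b (q.fst - q'.fst))] at h2
  rw [WithLp.prod_inner_apply]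
  change 0 ≤ ⟪w.fst - w'.fst, q.fst - q'.fst⟫_ℝ + ⟪w.snd - w'.snd, q.snd - q'.snd⟫_ℝ
  linarith

/-- The perturbation which turns the inclusion `0 ∈ H K G F b q` into the optimality system. -/
noncomputable def linearizationError (K : X → Y) (b : X) (q : WithLp 2 (X × Y)) : WithLp 2 (X × Y) :=
  WithLp.toLp 2 (gradAdj K q.fst q.snd - gradAdj K b q.snd,
    K b + fderiv ℝ K b (q.fst - b) - K q.fst)

theorem linearizationError_self (q : WithLp 2 (X × Y)) : linearizationError K q.fst q = 0 := by
  simp [linearizationError]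

theorem norm_linearizationError_sub_le (hK : Differentiable ℝ K) {L : ℝ≥0} {r : ℝ}
    {qhat : WithLp 2 (X × Y)}
    (hL : LipschitzOnWith L (fderiv ℝ K) (Metric.closedBall qhat.fst r))
    {q q' : WithLp 2 (X × Y)} (hq : ‖q - qhat‖ ≤ r) (hq' : ‖q' - qhat‖ ≤ r) :
    ‖linearizationError K qhat.fst q' - linearizationError K qhat.fst q‖
      ≤ (L * ‖qhat.snd‖ + 3 * (L * r)) * ‖q' - q‖ := by
  have hr : 0 ≤ r := (norm_nonneg _).trans hq
  have hb : qhat.fst ∈ Metric.closedBall qhat.fst r := Metric.mem_closedBall_self hr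
  have hu : q.fst ∈ Metric.closedBall qhat.fst r :=
    mem_closedBall_iff_norm.2 ((WithLp.norm_fst_le _ (q - qhat)).trans hq)
  have hu' : q'.fst ∈ Metric.closedBall qhat.fst r :=
    mem_closedBall_iff_norm.2 ((WithLp.norm_fst_le _ (q' - qhat)).trans hq')
  have hdu : ‖q'.fst - q.fst‖ ≤ ‖q' - q‖ := WithLp.norm_fst_le _ (q' - q)
  have hdv : ‖q'.snd - q.snd‖ ≤ ‖q' - q‖ := WithLp.norm_snd_le _ (q' - q)
  have hLb : ∀ x ∈ Metric.closedBall qhat.fst r,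
      ‖fderiv ℝ K x - fderiv ℝ K qhat.fst‖ ≤ L * r := fun x hx =>
    (hL.norm_sub_le hx hb).trans (by gcongr; exact mem_closedBall_iff_norm.1 hx)
  have hv' : ‖q'.snd‖ ≤ ‖qhat.snd‖ + r := by
    have h1 : ‖q'.snd - qhat.snd‖ ≤ r := (WithLp.norm_snd_le _ (q' - qhat)).trans hq'
    linarith [norm_le_norm_add_norm_sub' q'.snd qhat.snd]
  refine (norm_le_norm_fst_add_norm_snd _).trans ?_
  -- Only the variation of the adjoint, applied to `q'.snd`, leaves a contribution that does not
  -- vanish with `r`: this is `L * ‖qhat.snd‖`.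
  have h1 : ‖(linearizationError K qhat.fst q' - linearizationError K qhat.fst q).fst‖
      ≤ (L * ‖q' - q‖) * (‖qhat.snd‖ + r) + L * r * ‖q' - q‖ := by
    have h2 : (linearizationError K qhat.fst q' - linearizationError K qhat.fst q).fst
        = (gradAdj K q'.fst - gradAdj K q.fst) q'.snd
          + (gradAdj K q.fst - gradAdj K qhat.fst) (q'.snd - q.snd) := by
      change (gradAdj K q'.fst q'.snd - gradAdj K qhat.fst q'.snd)
        - (gradAdj K q.fst q.snd - gradAdj K qhat.fst q.snd) = _
      simp only [sub_apply, map_sub]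
      abel
    rw [h2]
    refine (norm_add_le _ _).trans (add_le_add ?_ ?_)
    · refine (ContinuousLinearMap.le_opNorm _ _).trans ?_
      rw [norm_gradAdj_sub]
      have h3 := hL.norm_sub_le hu' hu
      gcongr
      exact h3.trans (by gcongr)
    · refine (ContinuousLinearMap.le_opNorm _ _).trans ?_
      rw [norm_gradAdj_sub]
      have h3 := hLb _ hu
      gcongr
  have h2 : ‖(linearizationError K qhat.fst q' - linearizationError K qhat.fst q).snd‖
      ≤ L * r * ‖q' - q‖ := by
    have h3 : (linearizationError K qhat.fst q' - linearizationError K qhat.fst q).snd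
        = -(K q'.fst - K q.fst - fderiv ℝ K qhat.fst (q'.fst - q.fst)) := by
      change (K qhat.fst + fderiv ℝ K qhat.fst (q'.fst - qhat.fst) - K q'.fst)
        - (K qhat.fst + fderiv ℝ K qhat.fst (q.fst - qhat.fst) - K q.fst) = _
      simp only [map_sub]
      abel
    rw [h3, norm_neg]
    exact (norm_sub_sub_fderiv_le hK hLb hu hu').trans (by gcongr)
  linarith

/-- A step with `ω = 1` is a perturbed proximal step for `H K G F b`. -/
theorem IsStep.exists_inclusion (hG : IsConvexFunctional G) (hF : IsConvexFunctional F)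
    (hK : Differentiable ℝ K) {L : ℝ≥0} {r : ℝ} {qhat : WithLp 2 (X × Y)}
    (hcrit : IsCriticalPoint K G F qhat)
    (hL : LipschitzOnWith L (fderiv ℝ K) (Metric.closedBall qhat.fst (3 * r)))
    {τ σ : ℝ} (hτ : 0 < τ) (hσ : 0 < σ)
    {q q' : WithLp 2 (X × Y)} (hq : ‖q - qhat‖ ≤ r) (hq' : ‖q' - qhat‖ ≤ r)
    (h : IsStep K G F τ σ 1 q q') :
    ∃ d, ‖d‖ ≤ 6 * (L * r) * ‖q' - q‖ ∧
      -precondLinear K τ σ qhat.fst (q' - q) - linearizationError K qhat.fst q - d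
        ∈ H K G F qhat.fst q' := by
  have hr : 0 ≤ r := (norm_nonneg _).trans hq
  have hb : qhat.fst ∈ Metric.closedBall qhat.fst (3 * r) :=
    Metric.mem_closedBall_self (by positivity)
  have hu : ‖q.fst - qhat.fst‖ ≤ r := (WithLp.norm_fst_le _ (q - qhat)).trans hq
  have hu' : ‖q'.fst - qhat.fst‖ ≤ r := (WithLp.norm_fst_le _ (q' - qhat)).trans hq'
  have hdu : ‖q'.fst - q.fst‖ ≤ ‖q' - q‖ := WithLp.norm_fst_le _ (q' - q)
  have hLb : ∀ x ∈ Metric.closedBall qhat.fst (3 * r),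
      ‖fderiv ℝ K x - fderiv ℝ K qhat.fst‖ ≤ L * (3 * r) := fun x hx =>
    (hL.norm_sub_le hx hb).trans (by gcongr; exact mem_closedBall_iff_norm.1 hx)
  set ubar := q'.fst + (1 : ℝ) • (q'.fst - q.fst) with hubar
  have hubar_mem : ubar ∈ Metric.closedBall qhat.fst (3 * r) := by
    rw [mem_closedBall_iff_norm, show ubar - qhat.fst = (q'.fst - qhat.fst) +
      ((q'.fst - qhat.fst) - (q.fst - qhat.fst)) by rw [hubar, one_smul]; abel]
    refine (norm_add_le _ _).trans ?_
    linarith [norm_sub_le (q'.fst - qhat.fst) (q.fst - qhat.fst)]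
  -- The primal row is exact. The dual row errs by the linearization of `K` between `q.fst` and
  -- `ubar`; radius 3r times distance 2‖q' - q‖ gives the constant 6.
  refine ⟨WithLp.toLp 2 (0, -(K ubar - K q.fst - fderiv ℝ K qhat.fst (ubar - q.fst))), ?_, ?_, ?_⟩
  · refine (norm_le_norm_fst_add_norm_snd _).trans ?_
    change ‖(0 : X)‖ + ‖-(K ubar - K q.fst - fderiv ℝ K qhat.fst (ubar - q.fst))‖ ≤ _
    rw [norm_zero, zero_add, norm_neg]
    have h1 := norm_sub_sub_fderiv_le hK hLb
      (mem_closedBall_iff_norm.2 (hu.trans (by linarith))) hubar_mem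
    have h2 : ‖ubar - q.fst‖ ≤ 2 * ‖q' - q‖ := by
      rw [show ubar - q.fst = (2 : ℝ) • (q'.fst - q.fst) by rw [hubar]; module, norm_smul]
      norm_num
      exact hdu
    calc _ ≤ L * (3 * r) * (2 * ‖q' - q‖) := h1.trans (by gcongr)
      _ = 6 * (L * r) * ‖q' - q‖ := by ring
  · convert h.primal_mem_subdiff hG hτ using 1
    change -(τ⁻¹ • (q'.fst - q.fst) - gradAdj K qhat.fst (q'.snd - q.snd))
      - (gradAdj K q.fst q.snd - gradAdj K qhat.fst q.snd) - 0 - gradAdj K qhat.fst q'.snd = _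
    rw [map_sub, smul_sub τ⁻¹ (q.fst - _), smul_sub τ⁻¹ q.fst, inv_smul_smul₀ hτ.ne', smul_sub]
    abel
  · convert h.dual_mem_subdiff hF hcrit hσ using 1
    change -(-(fderiv ℝ K qhat.fst (q'.fst - q.fst)) + σ⁻¹ • (q'.snd - q.snd))
      - (K qhat.fst + fderiv ℝ K qhat.fst (q.fst - qhat.fst) - K q.fst)
      - -(K ubar - K q.fst - fderiv ℝ K qhat.fst (ubar - q.fst)) + fderiv ℝ K qhat.fst q'.fst
      + (K qhat.fst - fderiv ℝ K qhat.fst qhat.fst) = σ⁻¹ • (q.snd + σ • K ubar - q'.snd)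
    rw [smul_sub σ⁻¹ (q.snd + _), smul_add σ⁻¹ q.snd, inv_smul_smul₀ hσ.ne', smul_sub,
      show ubar - q.fst = (q'.fst - q.fst) + (q'.fst - q.fst) by rw [hubar, one_smul]; abel]
    simp only [map_sub, map_add]
    abel

theorem isCriticalPoint_of_zero_mem_H {q : WithLp 2 (X × Y)} (h : 0 ∈ H K G F q.fst q) :
    IsCriticalPoint K G F q := by
  obtain ⟨h1, h2⟩ := h
  refine ⟨?_, ?_⟩
  · simpa using h2
  · simpa using h1

end Steps

end NonlinearPDHG

/-! ### Assembly of the convergence theorem. -/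

theorem mainTheorem2
    {X Y : Type*} [NormedAddCommGroup X] [InnerProductSpace ℝ X] [CompleteSpace X]
    [NormedAddCommGroup Y] [InnerProductSpace ℝ Y] [CompleteSpace Y]
    (K : X → Y) (G : X → EReal) (F : Y → EReal)
    (hG : NonlinearPDHG.IsConvexFunctional G) (hF : NonlinearPDHG.IsConvexFunctional F)
    (hK : Differentiable ℝ K) (hK' : LocallyLipschitz (fderiv ℝ K))
    -- a solution of the optimality system in the ball of radius `R / 2`
    (R : ℝ) (hR : 0 < R) (qhat : WithLp 2 (X × Y))
    (hqhat : 0 ∈ NonlinearPDHG.H K G F qhat.fst qhat) (hqhatR : ‖qhat‖ ≤ R / 2)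
    (L₂ : ℝ≥0) (hL₂ : LipschitzOnWith L₂ (fderiv ℝ K) (Metric.closedBall 0 R))
    -- strong convexity of `G` and the step length rule, accelerated for `N` steps
    (γG : ℝ) (hγG : 0 < γG) (hGγ : NonlinearPDHG.IsStronglyConvex G γG)
    (μ : ℝ) (hμ : μ ∈ Set.Ico 0 γG) (N : ℕ) (τ σ ω : ℕ → ℝ)
    (hrule : NonlinearPDHG.IsPrimalAcceleration μ N τ σ ω)
    (hστ : ∀ i, σ i * τ i * (⨆ u : Metric.closedBall (0 : X) R, ‖fderiv ℝ K u‖ ^ 2) < 1)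
    -- uniform bounds `θ² Id ≤ M_i ≤ Θ² Id` of the preconditioners
    (θ Θ : ℝ) (hθ : 0 < θ) (hΘ : 0 < Θ)
    (hM : ∀ i, ∀ u ∈ Metric.closedBall (0 : X) R, ∀ q : WithLp 2 (X × Y),
      θ ^ 2 * ‖q‖ ^ 2 ≤ ⟪NonlinearPDHG.precond K (τ i) (σ i) u q, q⟫_ℝ ∧
      ⟪NonlinearPDHG.precond K (τ i) (σ i) u q, q⟫_ℝ ≤ Θ ^ 2 * ‖q‖ ^ 2)
    (κ : ℝ) (hκ : κ = Θ / θ)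
    -- metric regularity and the smallness condition, whose right-hand side is `1` if `ℓ = 0`
    (hreg : NonlinearPDHG.MetricallyRegular (NonlinearPDHG.H K G F qhat.fst) 0 qhat)
    (ℓ : ℝ) (hℓ : ℓ = NonlinearPDHG.lipInv (NonlinearPDHG.H K G F qhat.fst) 0 qhat)
    (hsmall : 0 < ℓ → ℓ * κ * L₂ * ‖qhat.snd‖ < 1 - 1 / √(1 + 1 / (2 * ℓ ^ 2 * Θ ^ 4)))
    -- the dual step uses `σ i` if `s = 0` and `σ (i + 1)` if `s = 1`
    (s : ℕ) (hs : s = 0 ∨ s = 1) :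
    ∃ δ > 0, ∀ q₀ : WithLp 2 (X × Y), ‖q₀ - qhat‖ ≤ δ →
      (∃ q : ℕ → WithLp 2 (X × Y), q 0 = q₀ ∧
        NonlinearPDHG.IsIterateSeq K G F τ σ ω s q) ∧
      ∀ q : ℕ → WithLp 2 (X × Y), q 0 = q₀ →
        NonlinearPDHG.IsIterateSeq K G F τ σ ω s q →
        ∃ qstar : WithLp 2 (X × Y), Tendsto q atTop (𝓝 qstar) ∧
          NonlinearPDHG.IsCriticalPoint K G F qstar := by

  open NonlinearPDHG in
  have hcrit := isCriticalPoint_of_zero_mem_H hqhat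
  have hτ := hrule.tau_pos' hμ.1
  have hσ := hrule.sigma_pos' hμ.1
  have hKc := hK.continuous
  have hKc' := hK'.continuous
  have hMN := fun q => hM N qhat.fst (mem_closedBall_zero_iff.2
    ((WithLp.norm_fst_le _ qhat).trans (hqhatR.trans (by linarith)))) q
  have hset : ∀ x ∈ {ℓ | IsRegularityModulus (H K G F qhat.fst) 0 qhat ℓ}, 0 ≤ x :=
    fun x hx => hx.1.le
  have hℓ0 : 0 ≤ ℓ := hℓ ▸ Real.sInf_nonneg hset
  -- One slack `ε` serves for the regularity constant above the infimum, the Lipschitz constant of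
  -- the linearization error and the step error.
  obtain ⟨ε, hε, hεθ, hfactor⟩ := exists_contractionFactor_lt_one (η := L₂ * ‖qhat.snd‖) hθ hΘ hℓ0
    (fun h => by rw [← mul_assoc, ← hκ]; exact hsmall h)
  obtain ⟨ℓ', hℓ', hlt⟩ := exists_lt_of_csInf_lt hreg.2
    (show lipInv (H K G F qhat.fst) 0 qhat < ℓ + ε by linarith)
  obtain ⟨ρ, hρ, hnear⟩ := IsRegularityModulus.exists_near hℓ' hlt
  simp only [sub_zero] at hnear
  have hη : 0 ≤ L₂ * ‖qhat.snd‖ := by positivity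
  obtain ⟨r, hr, hrR, hrε, hrρ, hgρ⟩ : ∃ r > 0, 3 * r ≤ R / 2 ∧ 6 * (L₂ * r) ≤ ε ∧
      (1 + 2 * (Θ / θ)) * r ≤ ρ ∧ (L₂ * ‖qhat.snd‖ + ε) * r ≤ ρ := by
    have hev : ∀ c d : ℝ, 0 < d → ∀ᶠ r in 𝓝[>] (0 : ℝ), c * r ≤ d := fun c d hd => by
      have hlim : Tendsto (fun r : ℝ => c * r) (𝓝[>] 0) (𝓝 0) := by
        have := (continuous_const_mul c).tendsto (0 : ℝ)
        rw [mul_zero] at this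
        exact this.mono_left nhdsWithin_le_nhds
      exact (hlim.eventually_lt_const hd).mono fun _ => le_of_lt
    obtain ⟨r, h1, h2, h3, h4, h5⟩ := ((hev 3 (R / 2) (by positivity)).and ((hev (6 * L₂) ε hε).and
      ((hev _ ρ hρ).and ((hev _ ρ hρ).and self_mem_nhdsWithin)))).exists
    exact ⟨r, h5, h1, by linarith, h3, h4⟩
  have hball : Metric.closedBall qhat.fst (3 * r) ⊆ Metric.closedBall 0 R := by
    intro x hx
    rw [mem_closedBall_iff_norm] at hx
    rw [mem_closedBall_zero_iff]
    have h1 := norm_le_norm_add_norm_sub' x qhat.fst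
    linarith [WithLp.norm_fst_le _ qhat]
  have hL3 := hL₂.mono hball
  have hL1 := hL3.mono (Metric.closedBall_subset_closedBall (show r ≤ 3 * r by linarith))
  have hLr : 0 ≤ L₂ * r := by positivity
  obtain ⟨δ, hδ, hcauchy⟩ := exists_cauchySeq_of_steps (T := H K G F qhat.fst)
    (g := linearizationError K qhat.fst) (M := precondLinear K (τ N) (σ N) qhat.fst)
    (Z := IsStep K G F (τ N) (σ N) 1) (H_monotone hG hF qhat.fst) (precondLinear_symm _ _ _) hθ hΘ
    (fun q => (hMN q).1) (fun q => (hMN q).2) (by linarith) hη hε hεθ hfactor hnear hr hrρ hgρ hqhat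
    (linearizationError_self qhat)
    (fun q q' hq hq' => (norm_linearizationError_sub_le hK hL1 hq hq').trans
      (by gcongr; linarith))
    (fun q q' hq hq' h => by
      obtain ⟨d, hd, hdH⟩ := h.exists_inclusion hG hF hK hcrit hL3 (hτ N) (hσ N) hq hq'
      exact ⟨d, hd.trans (by gcongr), hdH⟩)
    (by
      obtain ⟨d, hd, hdist⟩ := Metric.nhds_basis_closedBall.eventually_iff.1
        (eventually_isStep_near hG hF hKc hKc' hcrit (hτ N) (hσ N) 1 hr)
      exact ⟨d, hd, fun q q' hq h => hdist (mem_closedBall_iff_norm.2 hq) q' h⟩)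
  obtain ⟨δ', hδ', hfirst⟩ := Metric.nhds_basis_closedBall.eventually_iff.1
    (eventually_iterate_near hG hF hKc hKc' hcrit hτ hσ (ω := ω) s N δ hδ)
  refine ⟨δ', hδ', fun q₀ hq₀ => ⟨exists_isIterateSeq (fun i q =>
    exists_isStep hG hF hcrit (hτ i) (hσ (i + s)) (ω i) q) q₀, fun q hq hiter => ?_⟩⟩
  -- From index `N` on `σ` is constant, so the shift `s` has no effect.
  have hsteps : ∀ i, IsStep K G F (τ N) (σ N) 1 (q (N + i)) (q (N + (i + 1))) := fun i => by
    have h := hiter.isStep (N + i)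
    rwa [hrule.tau_eq, add_assoc N i s, hrule.sigma_eq, hrule.omega_stop _ (by omega)] at h
  obtain ⟨qstar, hqstar⟩ := cauchySeq_tendsto_of_complete (hcauchy (fun i => q (N + i))
    (hfirst (mem_closedBall_iff_norm.2 hq₀) q hq hiter) hsteps)
  refine ⟨qstar, ?_, isCriticalPoint_of_tendsto hG hF hKc hKc' hcrit (hτ N) (hσ N) hsteps hqstar⟩
  rw [← tendsto_add_atTop_iff_nat N]
  simpa only [add_comm] using hqstar
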